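/- **Setting.** Let $A\subset\mathbb R^2$ be bounded, connected and Lebesgue measurable, let $O_1,\dots,O_l$ be pairwise disjoint, closed, bounded, path-connected obstacles, and let $A_d=A\setminus\bigcup_i O_i$. Let $t_1,\dots,t_n\in A_d$ be static targets. Fix a triangular grid of side length $a>0$ (arbitrary origin and orientation) and constants $r_{rob}>0$, $e\ge 0$, $r_{safe}\ge r_{rob}+e$, $r_{so}\ge a+r_{safe}$, $r_c\ge 2a+e$ and $r_{st}$. A grid vertex $v$ is *accessible* if the open disc $B(v,r_{safe})$ is contained in $A_d$. There are $m\ge 1$ robots starting at distinct accessible vertices. The passages of $A_d$ are at least $a+2r_{safe}$ wide, in the sense that the set of centres $c$ with $B(c,a/2+r_{safe})\subseteq A_d$ is connected. Moreover one of the following two requirements holds. * *Strict requirement:* $r_{st}\ge a+r_{safe}$, and the concave part of the boundary of $A_d$ has curvature at most $1/r_{st}$: call a unit vector $\nu$ an inner normal at $x\in\partial A_d$ if $B(x+d\nu,d)\subseteq A_d$ for some $d>0$; then each $x\in\partial A_d$ has an inner normal, and every inner normal $\nu$ at $x$ satisfies $B(x+r_{st}\nu,r_{st})\cap B(x,a+2r_{safe})\subseteq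 A_d$. * *Loose requirement:* $a\le\sqrt3\,(r_{st}-r_{safe}+r_{rob})$, and the boundary effect is negligible: $B(t_j,a/\sqrt3+r_{safe})\subseteq A_d$ for every target, and for every initial vertex $p$ there is $c$ with $|p-c|\le a/2$ and $B(c,a/2+r_{safe})\subseteq A_d$ (the entrance is as wide as a passage). **Algorithm.** Each robot keeps a map (the vertices it knows to be visited and those it knows to be inaccessible) and a set of known targets, all initially empty. The communication neighbours of a robot are the other robots within distance $r_c$. In each loop $k=0,1,2,\dots$, unless the search has been terminated: 1. Every robot records its own position and those of its communication neighbours as visited. 2. Every robot senses the targets within $r_{st}$ of it (omitting those that lie outside its own disc of radius $r_{rob}$ but in the disc of radius $r_{rob}$ around a communication neighbour). In situation I (the number of targets is known a priori) sensed targets are broadcast to all robots; in situation II (it is not known) they are only added to the robot's own set. 3. Communication neighbours exchange their maps, and every robot records those of its six neighbouring vertices that have a sensed object (a point outside $A_d$, at distance at most $r_{so}$ from the robot) closer than $r_{safe}$ as inaccessible. 4. The search is terminated, with all robots staying put from then on and broadcasting the targets they know, if for some robot: (situation I) the number of targets it knows equals the number of targets; (situation II) every grid neighbour of every vertex visited in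 its map is detected in its map, i.e. recorded as visited or as inaccessible. 5. Otherwise the robots choose one after another, those with larger $x$-coordinate first and, for equal $x$-coordinates, those with larger $y$-coordinate first. A vacant neighbour for a robot is one of its six neighbouring vertices such that no sensed object is closer than $r_{safe}$ to the connecting edge and which is neither occupied nor already chosen by a communication neighbour. The robot picks, uniformly at random, a vacant neighbour not visited in its map if there is one, otherwise a vacant visited neighbour if there is one, and otherwise stays. The choices are recorded as visited in the maps of the robot and of its communication neighbours, and all robots move. **Theorem.** In either situation, and for every number $m\ge1$ of robots, almost surely there is a finite time $k_0>0$ such that at all times $k\ge k_0$ every target has been detected, i.e. is in the set of known targets of some robot. -/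

import Mathlib

open MeasureTheory

noncomputable section

namespace GridSearch

/-- The Euclidean plane. -/
abbrev Plane := EuclideanSpace ℝ (Fin 2)

/-- Index of a vertex of the triangular grid in the lattice basis of the grid. -/
abbrev Vertex := ℤ × ℤ

/-- Unit vector of direction `θ`. -/
def dir (θ : ℝ) : Plane := !₂[Real.cos θ, Real.sin θ]

/-- The six closest vertices around a vertex of the triangular grid. -/
def neighbours (v : Vertex) : Finset Vertex :=
  {(v.1 + 1, v.2), (v.1 - 1, v.2), (v.1, v.2 + 1), (v.1, v.2 - 1),
    (v.1 + 1, v.2 - 1), (v.1 - 1, v.2 + 1)}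

/-- Data of a 2D search task with `m` robots, `n` targets and `l` obstacles. -/
structure Setting (m n l : ℕ) where
  /-- the area -/
  area : Set Plane
  /-- the obstacles -/
  obstacle : Fin l → Set Plane
  /-- coordinates of the static targets -/
  target : Fin n → Plane
  /-- position of one vertex of the triangular grid -/
  origin : Plane
  /-- orientation of the triangular grid -/
  angle : ℝ
  /-- side length of the grid -/
  a : ℝ
  /-- swing radius of the robots -/
  rRob : ℝ
  /-- maximal odometry and measurement error -/
  err : ℝ
  /-- safety radius -/
  rSafe : ℝ
  /-- sensing range for obstacles -/
  rSo : ℝ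
  /-- sensing range for targets -/
  rSt : ℝ
  /-- communication range -/
  rC : ℝ
  /-- initial vertices of the robots -/
  start : Fin m → Vertex

/-! ### Geometry of the region to be searched -/

/-- `n` is an inner unit normal of `D` at `x`: a disc inside `D` touches `x` from the side `n`. -/
def InnerNormal (D : Set Plane) (x n : Plane) : Prop :=
  ‖n‖ = 1 ∧ ∃ d > 0, Metric.ball (x + d • n) d ⊆ D

/-- The concave part of the boundary of `D` has curvature at most `1 / R`, seen at scale `w`.
Every boundary point has an inner normal (`D` has no sharp corner or cusp with a tip of `D`, whose
curvature would be infinite), and on the side of every inner normal the tangent disc of radius `R`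
stays in `D` near the boundary point.  The opposite wall of a passage may cut this disc;
it is only looked at closer than `w` to the point, `w` being the minimal width of passages.
Convex parts of walls and obstacles, including their corners, may be arbitrarily sharp. -/
def ConcaveCurvatureLE (D : Set Plane) (R w : ℝ) : Prop :=
  ∀ x ∈ frontier D, (∃ n, InnerNormal D x n) ∧
    ∀ n, InnerNormal D x n → Metric.ball (x + R • n) R ∩ Metric.ball x w ⊆ D

/-- The passages of `D` have width at least `w`: the places at which a disc of diameter `w` fits
into `D` are not separated from each other by narrower passages, that is, the set of possible
centres of such a disc is connected. -/
def PassagesWide (D : Set Plane) (w : ℝ) : Prop :=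
  IsPreconnected {c : Plane | Metric.ball c (w / 2) ⊆ D}

namespace Setting

variable {m n l : ℕ} (S : Setting m n l)

/-- The region to be detected: the area without the obstacles. -/
def region : Set Plane := S.area \ ⋃ i, S.obstacle i

/-- Position of a vertex of the triangular grid of side `a`. -/
def loc (v : Vertex) : Plane :=
  S.origin + S.a • ((v.1 : ℝ) • dir S.angle + (v.2 : ℝ) • dir (S.angle + Real.pi / 3))

/-- A vertex is accessible when neither an obstacle nor the outside of the area comes closer
than the safety radius. -/
def Accessible (v : Vertex) : Prop := Metric.ball (S.loc v) S.rSafe ⊆ S.region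

/-- The standing assumptions on the area, the obstacles, the targets, the robots, the passages and
the ranges. -/
structure Assumptions : Prop where
  area_bounded : Bornology.IsBounded S.area
  area_connected : IsConnected S.area
  area_measurable : NullMeasurableSet S.area volume
  obstacle_closed : ∀ i, IsClosed (S.obstacle i)
  obstacle_bounded : ∀ i, Bornology.IsBounded (S.obstacle i)
  obstacle_connected : ∀ i, IsPathConnected (S.obstacle i)
  obstacle_disjoint : Pairwise fun i j => Disjoint (S.obstacle i) (S.obstacle j)
  target_mem : ∀ t, S.target t ∈ S.region
  a_pos : 0 < S.a
  rRob_pos : 0 < S.rRob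
  err_nonneg : 0 ≤ S.err
  rSafe_ge : S.rRob + S.err ≤ S.rSafe
  rSo_ge : S.a + S.rSafe ≤ S.rSo
  rC_ge : 2 * S.a + S.err ≤ S.rC
  passages : PassagesWide S.region (S.a + 2 * S.rSafe)
  start_injective : Function.Injective S.start
  start_accessible : ∀ i, S.Accessible (S.start i)

/-- The strict requirement: every point of the region can carry a target. -/
structure StrictRequirement : Prop where
  rSt_ge : S.a + S.rSafe ≤ S.rSt
  curvature : ConcaveCurvatureLE S.region S.rSt (S.a + 2 * S.rSafe)

/-- The loose requirement: the boundary effect is negligible.  No target lies in the strip along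
the boundary and the obstacles whose width is the circumradius of a grid triangle plus
the safety radius, and the entrance, where the robots start, is itself as wide as
a passage: a disc of diameter `a + 2 * rSafe` that contains the safety disc of the robot fits. -/
structure LooseRequirement : Prop where
  rSt_ge : S.a ≤ Real.sqrt 3 * (S.rSt - S.rSafe + S.rRob)
  target_inner : ∀ t, Metric.ball (S.target t) (S.a / Real.sqrt 3 + S.rSafe) ⊆ S.region
  entrance : ∀ i, ∃ c : Plane, dist (S.loc (S.start i)) c ≤ S.a / 2 ∧
    Metric.ball c (S.a / 2 + S.rSafe) ⊆ S.region

/-- The objects (points of obstacles or beyond the boundary) sensed by a robot at vertex `p`. -/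
def sensedObjects (p : Vertex) : Set Plane :=
  {y | y ∉ S.region ∧ dist y (S.loc p) ≤ S.rSo}

/-- A robot at `p` may move along the edge to `q`: no sensed object is closer than the safety
radius to the edge. -/
def FreeMove (p q : Vertex) : Prop :=
  ∀ y ∈ S.sensedObjects p, ∀ z ∈ segment ℝ (S.loc p) (S.loc q), S.rSafe ≤ dist y z

end Setting

/-! ### The algorithm -/

/-- Situation I: the number of targets is known to the robots.  Situation II: it is not. -/
inductive Situation
  | I
  | II

/-- Joint state of the robots at the beginning of a loop of the algorithm. -/
structure State (m n : ℕ) where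
  /-- current vertex of each robot -/
  pos : Fin m → Vertex
  /-- vertices recorded as visited in the own map of each robot -/
  visited : Fin m → Finset Vertex
  /-- vertices recorded in the own map of each robot as inaccessible; they are detected
  from a neighbouring vertex -/
  blocked : Fin m → Finset Vertex
  /-- targets known to each robot -/
  known : Fin m → Finset (Fin n)
  /-- whether the search has been terminated -/
  stopped : Bool

namespace Setting

variable {m n l : ℕ} (S : Setting m n l) (s : State m n)

/-- The initial state. -/
def init : State m n where
  pos := S.start
  visited := fun _ => ∅
  blocked := fun _ => ∅
  known := fun _ => ∅
  stopped := false

open Classical in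
/-- Communication neighbours of robot `i`: the other robots within the range `rC`. -/
def comm (i : Fin m) : Finset (Fin m) :=
  Finset.univ.filter fun j => j ≠ i ∧ dist (S.loc (s.pos i)) (S.loc (s.pos j)) ≤ S.rC

/-- Robot `i` together with its communication neighbours. -/
def group (i : Fin m) : Finset (Fin m) := insert i (S.comm s i)

/-- Robot `j` has higher priority than robot `i`. -/
def Higher (j i : Fin m) : Prop :=
  S.loc (s.pos i) 0 < S.loc (s.pos j) 0 ∨
    (S.loc (s.pos j) 0 = S.loc (s.pos i) 0 ∧ S.loc (s.pos i) 1 < S.loc (s.pos j) 1)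

open Classical in
/-- All robots, those of higher priority first. -/
def order : List (Fin m) :=
  (List.finRange m).mergeSort fun i j => decide (¬ S.Higher s j i)

open Classical in
/-- Targets sensed by robot `i`.  The zones occupied by its communication neighbours are left out
(these robots sense them), its own zone is not. -/
def sensedTargets (i : Fin m) : Finset (Fin n) :=
  Finset.univ.filter fun t => dist (S.target t) (S.loc (s.pos i)) ≤ S.rSt ∧
    (dist (S.target t) (S.loc (s.pos i)) ≤ S.rRob ∨
      ∀ j ∈ S.comm s i, S.rRob < dist (S.target t) (S.loc (s.pos j)))

/-- Targets known to robot `i` after sensing.  In situation I sensed targets are broadcast to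
all robots at once. -/
def known' (sit : Situation) (i : Fin m) : Finset (Fin n) :=
  match sit with
  | .I => s.known i ∪ Finset.univ.biUnion (S.sensedTargets s)
  | .II => s.known i ∪ S.sensedTargets s i

/-- The visited vertices in the map of robot `i` after the exchange of positions. -/
def visited₁ (i : Fin m) : Finset Vertex := s.visited i ∪ (S.group s i).image s.pos

/-- The visited vertices in the map of robot `i` after the exchange of maps. -/
def visited₂ (i : Fin m) : Finset Vertex := (S.group s i).biUnion (S.visited₁ s)

open Classical in
/-- The inaccessible vertices in the map of robot `i` after the exchange of maps and after sensing
the obstacles within the safety radius of the neighbouring vertices. -/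
def blocked' (i : Fin m) : Finset Vertex :=
  (S.group s i).biUnion s.blocked ∪
    (neighbours (s.pos i)).filter fun q =>
      ∃ y ∈ S.sensedObjects (s.pos i), dist y (S.loc q) < S.rSafe

/-- The condition under which robot `i` calls the stop.  Situation I: it knows as many targets as
there are.  Situation II: in its map, all neighbours of the visited vertices are detected, a vertex
being detected when it is visited or found to be inaccessible. -/
def Stops (sit : Situation) (i : Fin m) : Prop :=
  match sit with
  | .I => (S.known' s .I i).card = n
  | .II => ∀ v ∈ S.visited₂ s i, ∀ q ∈ neighbours v, q ∈ S.visited₂ s i ∪ S.blocked' s i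

open Classical in
/-- Vacant neighbouring vertices robot `i` can go to, when `c` holds the choices made so far (those
of the robots of higher priority): neither occupied nor already chosen by a communication
neighbour. -/
def vacant (c : Fin m → Option Vertex) (i : Fin m) : Finset Vertex :=
  (neighbours (s.pos i)).filter fun q =>
    S.FreeMove (s.pos i) q ∧ ∀ j ∈ S.comm s i, s.pos j ≠ q ∧ c j ≠ some q

open Classical in
/-- The random choice of robot `i`: uniform among the unvisited vacant neighbours if there are any,
otherwise uniform among the visited ones, otherwise stay. -/
def choiceLaw (c : Fin m → Option Vertex) (i : Fin m) : PMF Vertex :=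
  if hu : (S.vacant s c i \ S.visited₂ s i).Nonempty then
    PMF.uniformOfFinset (S.vacant s c i \ S.visited₂ s i) hu
  else if hv : (S.vacant s c i ∩ S.visited₂ s i).Nonempty then
    PMF.uniformOfFinset (S.vacant s c i ∩ S.visited₂ s i) hv
  else PMF.pure (s.pos i)

/-- The robots of the list choose one after the other. -/
def choose : List (Fin m) → (Fin m → Option Vertex) → PMF (Fin m → Option Vertex)
  | [], c => PMF.pure c
  | i :: L, c => (S.choiceLaw s c i).bind fun q => choose L (Function.update c i (some q))

/-- The state after all robots have moved according to the choices `c`, which are also recorded in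
the maps of the communication neighbours. -/
def move (sit : Situation) (c : Fin m → Option Vertex) : State m n where
  pos := fun i => (c i).getD (s.pos i)
  visited := fun i => S.visited₂ s i ∪ (S.group s i).image fun j => (c j).getD (s.pos j)
  blocked := S.blocked' s
  known := S.known' s sit
  stopped := false

/-- The state after the stop has been called: nobody moves any more, and all robots broadcast
the targets they know. -/
def halt (sit : Situation) : State m n where
  pos := s.pos
  visited := S.visited₂ s
  blocked := S.blocked' s
  known := fun _ => Finset.univ.biUnion (S.known' s sit)
  stopped := true

open Classical in
/-- One loop of the algorithm. -/
def step (sit : Situation) : PMF (State m n) :=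
  if s.stopped = true then PMF.pure s
  else if ∃ i, S.Stops s sit i then PMF.pure (S.halt s sit)
  else (S.choose s (S.order s) fun _ => none).map (S.move s sit)

/-- `X` is a run of the algorithm: the Markov chain that starts in the initial state and
has transition law `step`. -/
structure Runs {Ω : Type*} [MeasurableSpace Ω] (sit : Situation) (μ : Measure Ω)
    (X : ℕ → Ω → State m n) : Prop where
  measurable : ∀ k x, MeasurableSet {ω | X k ω = x}
  init : ∀ᵐ ω ∂μ, X 0 ω = S.init
  markov : ∀ (k : ℕ) (h : ℕ → State m n),
    μ {ω | ∀ j ≤ k + 1, X j ω = h j} =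
      μ {ω | ∀ j ≤ k, X j ω = h j} * S.step (h k) sit (h (k + 1))

end Setting

end GridSearch

end

/-!
The theorem separates into geometry and probability.

*Geometry.* Let `C` be the set of centres of the discs of the width of a passage that lie in the
region; it is connected by assumption. Call a vertex of a grid triangle touched if it is within half
a grid side of a point of `C` in the triangle. Two touched vertices of the same triangle are always
joined by a free edge, because in a sector of 60° points close to the apex are close to each other
(`dist_le_of_sector`). A point of `C` on two triangles lies on an edge and so touches an end of it,
a vertex of both. Hence the triangles with a touched vertex in a given component of the graph of
free edges and the other triangles cut `C` into two relatively closed sets, one of which is empty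
(`exists_touched`): all robots start in the same component, and it has a vertex in each triangle
that meets `C`. It remains to see every target from this component. Under the loose requirement the
target is itself in `C`, and the vertex of its triangle within the circumradius belongs to the
component. Under the strict requirement a target close to the boundary lies on an inner normal,
which carries a point `c` of `C`; a vertex of the triangle around `c` lies in the intersection of
two discs whose radius is the grid side and whose centres are the ends of a segment of that length
with midpoint `c` (`exists_dist_le_both`), and from there the target is seen.

*Probability.* On a finite component the joint state runs through a finite set. From every state
all targets become known with positive probability (`exists_reachable_allKnown`): consider a robot
and the next vertex `q` on its way to a place from which an unknown target is seen. If it cannot go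
to `q`, another robot occupies or has chosen `q`, which is as good, or it prefers a vertex missing
in its map, which can happen only finitely often. Thus the chain is absorbed almost surely
(`ae_exists_mem_of_reachable`). The stop is never called too early: in situation II the visited
vertices of the robot that calls it are closed under free edges, so they exhaust the component.
-/

namespace GridSearch

open scoped ENNReal

/-! ### Absorption of a finite Markov chain -/

section Markov

variable {σ : Type*}

/-- The transition operator of the kernel `P`: the mean of `f` after one transition from `x`. -/
noncomputable def transition (P : σ → PMF σ) (f : σ → ℝ≥0∞) (x : σ) : ℝ≥0∞ :=
  ∑' y, P x y * f y

variable {P : σ → PMF σ}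

lemma transition_mono_on {F : Set σ} (hF : ∀ x ∈ F, ∀ y ∈ (P x).support, y ∈ F)
    {f g : σ → ℝ≥0∞} (hfg : ∀ x ∈ F, f x ≤ g x) (k : ℕ) :
    ∀ x ∈ F, ((transition P)^[k] f) x ≤ ((transition P)^[k] g) x := by
  induction k generalizing f g with
  | zero => exact hfg
  | succ k ih =>
    simp only [Function.iterate_succ_apply]
    refine ih fun x hx => ENNReal.tsum_le_tsum fun y => ?_
    by_cases hy : y ∈ (P x).support
    · gcongr; exact hfg y (hF x hx y hy)
    · rw [PMF.mem_support_iff, not_not] at hy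
      simp [hy]

lemma transition_iterate_mul (c : ℝ≥0∞) (f : σ → ℝ≥0∞) (k : ℕ) :
    (transition P)^[k] (fun x => c * f x) = fun x => c * ((transition P)^[k] f) x := by
  induction k generalizing f with
  | zero => rfl
  | succ k ih =>
    simp only [Function.iterate_succ_apply]
    rw [← ih]
    congr 1
    funext x
    simp only [transition, ← ENNReal.tsum_mul_left]
    exact tsum_congr fun y => by ring

lemma transition_iterate_le_one {f : σ → ℝ≥0∞} (hf : ∀ x, f x ≤ 1) (k : ℕ) (x : σ) :
    ((transition P)^[k] f) x ≤ 1 := by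
  induction k generalizing x with
  | zero => exact hf x
  | succ k ih =>
    rw [Function.iterate_succ_apply']
    calc transition P ((transition P)^[k] f) x ≤ ∑' y, P x y * 1 := by
          unfold transition; gcongr; exact ih _
      _ = 1 := by simp [PMF.tsum_coe]

variable {Ω : Type*} [MeasurableSpace Ω]

lemma measure_eq_tsum_fiber [Countable σ] (μ : Measure Ω) {Y : Ω → σ}
    (hY : ∀ x, MeasurableSet {ω | Y ω = x}) (B : Set Ω) :
    μ B = ∑' x, μ (B ∩ {ω | Y ω = x}) := by
  have hd : Pairwise (Function.onFun Disjoint fun x => {ω | Y ω = x}) := by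
    intro x y hxy
    exact Set.disjoint_left.2 fun ω h1 h2 => hxy (h1.symm.trans h2)
  have hU : (⋃ x, {ω | Y ω = x}) = Set.univ := by
    ext ω; simp
  have := measure_iUnion (μ := μ.restrict B) hd hY
  rw [hU, Measure.restrict_apply_univ] at this
  rw [this]
  exact tsum_congr fun x => by rw [Measure.restrict_apply (hY x), Set.inter_comm]

variable [Countable σ] {μ : Measure Ω} {X : ℕ → Ω → σ}

/-- The Markov property with the history before time `k` summed out. -/
lemma measure_pair (hX : ∀ k x, MeasurableSet {ω | X k ω = x})
    (hP : ∀ (k : ℕ) (h : ℕ → σ), μ {ω | ∀ j ≤ k + 1, X j ω = h j} =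
      μ {ω | ∀ j ≤ k, X j ω = h j} * P (h k) (h (k + 1))) (k : ℕ) (x y : σ) :
    μ ({ω | X (k + 1) ω = y} ∩ {ω | X k ω = x}) = μ {ω | X k ω = x} * P x y := by
  have hY : ∀ g : Fin k → σ, MeasurableSet {ω | (fun j : Fin k => X j ω) = g} := by
    intro g
    have : {ω | (fun j : Fin k => X j ω) = g} = ⋂ j : Fin k, {ω | X j ω = g j} := by
      ext ω; simp [funext_iff]
    rw [this]
    exact MeasurableSet.iInter fun j => hX _ _
  rw [measure_eq_tsum_fiber μ hY, measure_eq_tsum_fiber μ hY {ω | X k ω = x},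
    ← ENNReal.tsum_mul_right]
  refine tsum_congr fun g => ?_
  -- The Markov property is used along the history `g` followed by `x` and `y`.
  set h : ℕ → σ := fun j => if hj : j < k then g ⟨j, hj⟩ else if j = k then x else y with hh
  have e0 : h k = x := by simp [hh]
  have e1 : h (k + 1) = y := by simp [hh]
  have e2 : ∀ j (hj : j < k), h j = g ⟨j, hj⟩ := fun j hj => by simp [hh, hj]
  have key := hP k h
  have s2 : {ω | ∀ j ≤ k, X j ω = h j} =
      {ω | X k ω = x} ∩ {ω | (fun j : Fin k => X j ω) = g} := by
    ext ω
    simp only [Set.mem_ofPred_eq, Set.mem_inter_iff, funext_iff]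
    constructor
    · intro H
      exact ⟨e0 ▸ H k le_rfl, fun j => by rw [H j j.2.le, e2 j j.2]⟩
    · rintro ⟨H1, H2⟩ j hj
      rcases hj.lt_or_eq with hj | rfl
      · rw [e2 j hj]; exact H2 ⟨j, hj⟩
      · rw [e0, H1]
  have s1 : {ω | ∀ j ≤ k + 1, X j ω = h j} =
      {ω | X (k + 1) ω = y} ∩ {ω | ∀ j ≤ k, X j ω = h j} := by
    ext ω
    simp only [Set.mem_ofPred_eq, Set.mem_inter_iff]
    constructor
    · intro H
      exact ⟨e1 ▸ H _ le_rfl, fun j hj => H j (by omega)⟩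
    · rintro ⟨H1, H2⟩ j hj
      rcases hj.lt_or_eq with hj | rfl
      · exact H2 j (by omega)
      · rw [e1, H1]
  rw [s1, s2, e0, e1] at key
  rw [Set.inter_assoc, key]

lemma tsum_measure_succ (hX : ∀ k x, MeasurableSet {ω | X k ω = x})
    (hP : ∀ (k : ℕ) (h : ℕ → σ), μ {ω | ∀ j ≤ k + 1, X j ω = h j} =
      μ {ω | ∀ j ≤ k, X j ω = h j} * P (h k) (h (k + 1))) (k : ℕ) (f : σ → ℝ≥0∞) :
    ∑' y, μ {ω | X (k + 1) ω = y} * f y = ∑' x, μ {ω | X k ω = x} * transition P f x := by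
  have h1 : ∀ y, μ {ω | X (k + 1) ω = y} * f y =
      ∑' x, μ {ω | X k ω = x} * (P x y * f y) := by
    intro y
    rw [measure_eq_tsum_fiber μ (hX k), ← ENNReal.tsum_mul_right]
    exact tsum_congr fun x => by rw [measure_pair hX hP, mul_assoc]
  simp_rw [h1]
  rw [ENNReal.tsum_comm]
  exact tsum_congr fun x => by rw [ENNReal.tsum_mul_left]; rfl

lemma tsum_measure_eq_iterate [IsProbabilityMeasure μ]
    (hX : ∀ k x, MeasurableSet {ω | X k ω = x})
    (hP : ∀ (k : ℕ) (h : ℕ → σ), μ {ω | ∀ j ≤ k + 1, X j ω = h j} =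
      μ {ω | ∀ j ≤ k, X j ω = h j} * P (h k) (h (k + 1)))
    {x₀ : σ} (h0 : ∀ᵐ ω ∂μ, X 0 ω = x₀) (k : ℕ) (f : σ → ℝ≥0∞) :
    ∑' x, μ {ω | X k ω = x} * f x = ((transition P)^[k] f) x₀ := by
  induction k generalizing f with
  | zero =>
    rw [tsum_eq_single x₀]
    · rw [(mem_ae_iff_prob_eq_one (hX 0 x₀)).1 h0]; simp
    · intro x hx
      have : μ {ω | X 0 ω = x} = 0 := by
        refine measure_mono_null ?_ h0
        intro ω hω h
        exact hx (hω.symm.trans h)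
      rw [this, zero_mul]
  | succ k ih => rw [tsum_measure_succ hX hP, ih, Function.iterate_succ_apply]

/-- A transition of probability zero almost surely never happens. -/
lemma ae_transition_mem_support (hX : ∀ k x, MeasurableSet {ω | X k ω = x})
    (hP : ∀ (k : ℕ) (h : ℕ → σ), μ {ω | ∀ j ≤ k + 1, X j ω = h j} =
      μ {ω | ∀ j ≤ k, X j ω = h j} * P (h k) (h (k + 1))) :
    ∀ᵐ ω ∂μ, ∀ k, X (k + 1) ω ∈ (P (X k ω)).support := by
  rw [ae_all_iff]
  intro k
  have : ∀ᵐ ω ∂μ, ∀ x y, ¬ (X (k + 1) ω = y ∧ X k ω = x ∧ P x y = 0) := by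
    rw [ae_all_iff]; intro x
    rw [ae_all_iff]; intro y
    rw [ae_iff]
    by_cases h : P x y = 0
    · have := measure_pair hX hP k x y
      rw [h, mul_zero] at this
      refine measure_mono_null ?_ this
      intro ω hω
      simp only [not_not, Set.mem_ofPred_eq] at hω
      exact ⟨hω.1, hω.2.1⟩
    · simp [h]
  filter_upwards [this] with ω hω
  rw [PMF.mem_support_iff]
  exact fun h => hω _ _ ⟨rfl, rfl, h⟩

/-- A Markov chain that stays in a finite set `F` almost surely reaches `G`, provided that `G` is
never left and can be reached from each state of `F` with positive probability: the probability
of not having reached `G` decays geometrically. -/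
theorem ae_exists_mem_of_reachable [IsProbabilityMeasure μ]
    (hX : ∀ k x, MeasurableSet {ω | X k ω = x})
    (hP : ∀ (k : ℕ) (h : ℕ → σ), μ {ω | ∀ j ≤ k + 1, X j ω = h j} =
      μ {ω | ∀ j ≤ k, X j ω = h j} * P (h k) (h (k + 1)))
    {x₀ : σ} (h0 : ∀ᵐ ω ∂μ, X 0 ω = x₀) {F G : Set σ} (hfin : F.Finite) (hx₀ : x₀ ∈ F)
    (hF : ∀ x ∈ F, ∀ y ∈ (P x).support, y ∈ F)
    (hG : ∀ x ∈ F, x ∈ G → ∀ y ∈ (P x).support, y ∈ G)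
    (hreach : ∀ x ∈ F, ∃ y ∈ G, Relation.ReflTransGen (fun x y => y ∈ (P x).support) x y) :
    ∀ᵐ ω ∂μ, ∃ k, X k ω ∈ G := by
  classical
  -- `q k x` is the probability of being outside `G` after `k` transitions from `x`.
  set q : ℕ → σ → ℝ≥0∞ := fun k => (transition P)^[k] (Gᶜ.indicator 1) with hq
  have hq0 : ∀ x, q 0 x ≤ 1 := fun x => Set.indicator_le_self' (by simp) x
  have hq1 : ∀ k x, q k x ≤ 1 := transition_iterate_le_one hq0
  have hanti1 : ∀ x ∈ F, q 1 x ≤ q 0 x := by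
    intro x hx
    by_cases hxG : x ∈ G
    · refine le_of_eq_of_le ?_ zero_le
      change ∑' y, P x y * (Gᶜ.indicator 1 y) = 0
      rw [ENNReal.tsum_eq_zero]
      intro y
      by_cases hy : y ∈ (P x).support
      · simp [hG x hx hxG y hy]
      · rw [PMF.mem_support_iff, not_not] at hy
        simp [hy]
    · have : q 0 x = 1 := by simp [hq, hxG]
      rw [this]; exact hq1 1 x
  have hanti : ∀ x ∈ F, Antitone fun k => q k x := by
    intro x hx
    refine antitone_nat_of_succ_le fun k => ?_
    have := transition_mono_on hF hanti1 k x hx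
    simp only [hq, ← Function.iterate_add_apply] at this ⊢
    simpa using this
  have hlt : ∀ x ∈ F, ∃ k, q k x < 1 := by
    intro x hx
    obtain ⟨y, hy, hxy⟩ := hreach x hx
    clear hx
    induction hxy using Relation.ReflTransGen.head_induction_on with
    | refl => exact ⟨0, by simp [hq, hy]⟩
    | @head u v h _ ih =>
      obtain ⟨k, hk⟩ := ih
      refine ⟨k + 1, ?_⟩
      have h2 : q (k + 1) u = ∑' y, P u y * q k y := by
        simp only [hq, Function.iterate_succ_apply']; rfl
      rw [h2]
      have hle : ∀ y, P u y * q k y ≤ P u y := fun y => mul_le_of_le_one_right' (hq1 k y)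
      calc ∑' y, P u y * q k y < ∑' y, P u y := by
            refine ENNReal.tsum_lt_tsum (i := v) ?_ hle ?_
            · exact ne_top_of_le_ne_top (by simp [PMF.tsum_coe]) (ENNReal.tsum_le_tsum hle)
            · conv_rhs => rw [← mul_one (P u v)]
              exact ENNReal.mul_lt_mul_right ((PMF.mem_support_iff _ _).1 h)
                (PMF.apply_ne_top _ _) hk
        _ = 1 := PMF.tsum_coe _
  choose! κ hκ using hlt
  set N := hfin.toFinset.sup κ
  set δ := hfin.toFinset.sup (q N)
  have hδ : δ < 1 := by
    rw [Finset.sup_lt_iff (by simp)]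
    intro x hx
    have hxF : x ∈ F := hfin.mem_toFinset.1 hx
    exact (hanti x hxF (Finset.le_sup hx)).trans_lt (hκ x hxF)
  have hstep : ∀ x ∈ F, q N x ≤ δ * q 0 x := by
    intro x hx
    by_cases hxG : x ∈ G
    · have h1 : q 0 x = 0 := by simp [hq, hxG]
      have := hanti x hx (Nat.zero_le N)
      simp only [h1] at this
      rw [h1, mul_zero]; exact this
    · have h1 : q 0 x = 1 := by simp [hq, hxG]
      rw [h1, mul_one]
      exact Finset.le_sup (f := q N) (hfin.mem_toFinset.2 hx)
  -- `N` transitions from anywhere multiply the probability of being outside `G` by at most `δ`.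
  have hpow : ∀ j, ∀ x ∈ F, q (N * j) x ≤ δ ^ j := by
    intro j
    induction j with
    | zero => intro x _; simpa using hq1 0 x
    | succ j ih =>
      intro x hx
      have h1 : q (N * (j + 1)) = (transition P)^[N * j] (q N) := by
        simp only [hq, ← Function.iterate_add_apply]; rfl
      rw [h1]
      refine (transition_mono_on hF hstep (N * j) x hx).trans ?_
      rw [transition_iterate_mul, pow_succ']
      exact mul_le_mul_right (ih x hx) δ
  have hmeas : ∀ k, μ {ω | X k ω ∉ G} = q k x₀ := by
    intro k
    change _ = (transition P)^[k] _ x₀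
    rw [← tsum_measure_eq_iterate hX hP h0, measure_eq_tsum_fiber μ (hX k)]
    refine tsum_congr fun x => ?_
    by_cases hx : x ∈ G
    · have : {ω | X k ω ∉ G} ∩ {ω | X k ω = x} = ∅ := by
        ext ω; simp only [Set.mem_inter_iff, Set.mem_ofPred_eq, Set.mem_empty_iff_false, iff_false]
        rintro ⟨h1, rfl⟩; exact h1 hx
      simp [this, hx]
    · have : {ω | X k ω ∉ G} ∩ {ω | X k ω = x} = {ω | X k ω = x} := by
        ext ω; simp only [Set.mem_inter_iff, Set.mem_ofPred_eq, and_iff_right_iff_imp]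
        rintro rfl; exact hx
      simp [this, hx]
  rw [ae_iff]
  refine le_antisymm (ge_of_tendsto' (ENNReal.tendsto_pow_atTop_nhds_zero_of_lt_one hδ)
    fun j => ?_) zero_le
  calc μ {ω | ¬ ∃ k, X k ω ∈ G} ≤ μ {ω | X (N * j) ω ∉ G} :=
        measure_mono fun ω hω h => hω ⟨_, h⟩
    _ ≤ δ ^ j := by rw [hmeas]; exact hpow j x₀ hx₀

end Markov

/-! ### The algorithm on a finite set of vertices closed under moves -/

namespace Setting

variable {m n l : ℕ} (S : Setting m n l)

/-- A step along an edge of the grid that the algorithm admits in the absence of other robots. -/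
def Edge (p q : Vertex) : Prop := q ∈ neighbours p ∧ S.FreeMove p q

/-- `K` is a connected component, under admissible moves, of the accessible vertices, it contains
all the initial vertices, and every target is within sensing range of one of its vertices. -/
structure SearchGraph (K : Finset Vertex) : Prop where
  start_mem : ∀ i, S.start i ∈ K
  edge_mem : ∀ p ∈ K, ∀ q, S.Edge p q → q ∈ K
  accessible : ∀ p ∈ K, S.Accessible p
  connected : ∀ p ∈ K, ∀ q ∈ K, Relation.ReflTransGen S.Edge p q
  cover : ∀ t, ∃ v ∈ K, dist (S.target t) (S.loc v) ≤ S.rSt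

/-- Every target is known to some robot. -/
def AllKnown (s : State m n) : Prop := ∀ t : Fin n, ∃ i, t ∈ s.known i

/-- The properties of the joint state that hold throughout a run. -/
structure Invariant (K : Finset Vertex) (s : State m n) : Prop where
  pos_mem : ∀ i, s.pos i ∈ K
  visited_subset : ∀ i, s.visited i ⊆ K
  blocked_subset : ∀ i, s.blocked i ⊆ K.biUnion neighbours
  blocked_not : ∀ i, ∀ q ∈ s.blocked i, ¬ S.Accessible q
  seen : ∀ i, ∀ v ∈ s.visited i, (∃ j, s.pos j = v) ∨
    ∀ t, dist (S.target t) (S.loc v) ≤ S.rSt → ∃ j, t ∈ s.known j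
  stopped : s.stopped = true → AllKnown s

/-- A state as a tuple. -/
def stateTuple (s : State m n) : (Fin m → Vertex) × (Fin m → Finset Vertex) ×
    (Fin m → Finset Vertex) × (Fin m → Finset (Fin n)) × Bool :=
  (s.pos, s.visited, s.blocked, s.known, s.stopped)

lemma stateTuple_injective : Function.Injective (stateTuple (m := m) (n := n)) := by
  rintro ⟨⟩ ⟨⟩ h
  simpa [stateTuple] using h

instance : Countable (State m n) := stateTuple_injective.countable

lemma finite_setOf_invariant (K : Finset Vertex) :
    {s : State m n | S.Invariant K s}.Finite := by
  have h1 : (Set.univ.pi fun _ : Fin m => (K : Set Vertex)).Finite :=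
    Set.Finite.pi fun _ => K.finite_toSet
  have h2 : ∀ B : Finset Vertex,
      (Set.univ.pi fun _ : Fin m => (B.powerset : Set (Finset Vertex))).Finite :=
    fun B => Set.Finite.pi fun _ => B.powerset.finite_toSet
  refine ((h1.prod ((h2 K).prod ((h2 (K.biUnion neighbours)).prod
    (Set.finite_univ (α := (Fin m → Finset (Fin n)) × Bool))))).preimage
      stateTuple_injective.injOn).subset ?_
  intro s hs
  simp only [Set.mem_preimage, stateTuple, Set.mem_prod, Set.mem_univ_pi, Finset.mem_coe,
    Finset.mem_powerset, Set.mem_univ, and_true]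
  exact ⟨hs.pos_mem, hs.visited_subset, hs.blocked_subset⟩

variable {S} {K : Finset Vertex} {s : State m n} {sit : Situation}

/-- A target within range of a robot is sensed by this robot or by the communication neighbour
whose zone covers it.  Should `rSt` be smaller than `rRob`, the robot senses it in its own zone. -/
lemma exists_mem_sensedTargets {i : Fin m} {t : Fin n}
    (h : dist (S.target t) (S.loc (s.pos i)) ≤ S.rSt) : ∃ j, t ∈ S.sensedTargets s j := by
  simp only [sensedTargets, Finset.mem_filter, Finset.mem_univ, true_and]
  by_cases hr : S.rRob ≤ S.rSt
  · by_cases hj : ∃ j ∈ S.comm s i, dist (S.target t) (S.loc (s.pos j)) ≤ S.rRob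
    · obtain ⟨j, -, hj⟩ := hj
      exact ⟨j, hj.trans hr, Or.inl hj⟩
    · push Not at hj
      exact ⟨i, h, Or.inr hj⟩
  · exact ⟨i, h, Or.inl (h.trans (not_le.1 hr).le)⟩

lemma known_subset_known' (i : Fin m) : s.known i ⊆ S.known' s sit i := by
  cases sit <;> exact Finset.subset_union_left

lemma sensedTargets_subset_known' (i : Fin m) : S.sensedTargets s i ⊆ S.known' s sit i := by
  cases sit
  · exact (Finset.subset_biUnion_of_mem (S.sensedTargets s) (Finset.mem_univ i)).trans
      Finset.subset_union_right
  · exact Finset.subset_union_right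

lemma exists_mem_known'_of_pos {i : Fin m} {t : Fin n}
    (h : dist (S.target t) (S.loc (s.pos i)) ≤ S.rSt) : ∃ j, t ∈ S.known' s sit j :=
  let ⟨j, hj⟩ := exists_mem_sensedTargets h
  ⟨j, sensedTargets_subset_known' j hj⟩

lemma mem_visited₂ {i : Fin m} {v : Vertex} (h : v ∈ S.visited₂ s i) :
    ∃ j, v ∈ s.visited j ∨ ∃ k, s.pos k = v := by
  simp only [visited₂, visited₁, Finset.mem_biUnion, Finset.mem_union, Finset.mem_image] at h
  obtain ⟨j, -, h | ⟨k, -, h⟩⟩ := h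
  exacts [⟨j, Or.inl h⟩, ⟨j, Or.inr ⟨k, h⟩⟩]

lemma self_mem_group (i : Fin m) : i ∈ S.group s i := Finset.mem_insert_self _ _

lemma visited_subset_visited₂ (i : Fin m) : s.visited i ⊆ S.visited₂ s i :=
  Finset.subset_union_left.trans (Finset.subset_biUnion_of_mem (S.visited₁ s) (self_mem_group i))

lemma pos_mem_visited₂ (i : Fin m) : s.pos i ∈ S.visited₂ s i :=
  Finset.mem_biUnion.2 ⟨i, self_mem_group i, Finset.mem_union_right _
    (Finset.mem_image_of_mem _ (self_mem_group i))⟩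

namespace Invariant

variable (hI : S.Invariant K s)
include hI

lemma visited₂_subset (i : Fin m) : S.visited₂ s i ⊆ K := by
  intro v hv
  obtain ⟨j, h | ⟨k, rfl⟩⟩ := mem_visited₂ hv
  exacts [hI.visited_subset j h, hI.pos_mem k]

lemma exists_mem_known' {i : Fin m} {v : Vertex} (hv : v ∈ S.visited₂ s i) {t : Fin n}
    (ht : dist (S.target t) (S.loc v) ≤ S.rSt) : ∃ j, t ∈ S.known' s sit j := by
  obtain ⟨j, h | ⟨k, rfl⟩⟩ := mem_visited₂ hv
  · obtain ⟨k, rfl⟩ | h := hI.seen j v h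
    · exact exists_mem_known'_of_pos ht
    · obtain ⟨k, hk⟩ := h t ht
      exact ⟨k, known_subset_known' k hk⟩
  · exact exists_mem_known'_of_pos ht

lemma blocked'_subset (i : Fin m) : S.blocked' s i ⊆ K.biUnion neighbours := by
  intro q hq
  simp only [blocked', Finset.mem_union, Finset.mem_biUnion, Finset.mem_filter] at hq
  obtain ⟨j, -, hq⟩ | ⟨hq, -⟩ := hq
  exacts [hI.blocked_subset j hq, Finset.mem_biUnion.2 ⟨_, hI.pos_mem i, hq⟩]

lemma blocked'_not (i : Fin m) : ∀ q ∈ S.blocked' s i, ¬ S.Accessible q := by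
  intro q hq hacc
  simp only [blocked', Finset.mem_union, Finset.mem_biUnion, Finset.mem_filter] at hq
  obtain ⟨j, -, hq⟩ | ⟨-, y, hy, hyq⟩ := hq
  exacts [hI.blocked_not j q hq hacc, hy.1 (hacc hyq)]

/-- The search is terminated only when all targets are known.  In situation II the visited vertices
in the map of the robot that calls the stop are closed under moves, hence exhaust `K`. -/
lemma allKnown_halt (hK : S.SearchGraph K) {i : Fin m} (hi : S.Stops s sit i) :
    AllKnown (S.halt s sit) := by
  suffices h : ∀ t, ∃ j, t ∈ S.known' s sit j by
    intro t
    obtain ⟨j, hj⟩ := h t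
    exact ⟨i, Finset.mem_biUnion.2 ⟨j, Finset.mem_univ _, hj⟩⟩
  intro t
  cases sit with
  | I =>
    have : S.known' s .I i = Finset.univ := by
      rw [← Finset.card_eq_iff_eq_univ, Fintype.card_fin]; exact hi
    exact ⟨i, this ▸ Finset.mem_univ t⟩
  | II =>
    obtain ⟨v, hv, htv⟩ := hK.cover t
    refine hI.exists_mem_known' (i := i) (v := v) ?_ htv
    have hpv := hK.connected _ (hI.pos_mem i) v hv
    clear htv
    have : v ∈ S.visited₂ s i ∧ v ∈ K := by
      clear hv
      induction hpv with
      | refl => exact ⟨pos_mem_visited₂ i, hI.pos_mem i⟩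
      | tail _ e ih =>
        have hqK := hK.edge_mem _ ih.2 _ e
        refine ⟨?_, hqK⟩
        obtain h | h := Finset.mem_union.1 (hi _ ih.1 _ e.1)
        · exact h
        · exact absurd (hK.accessible _ hqK) (hI.blocked'_not i _ h)
    exact this.1

end Invariant

/-! ### The random choices -/

lemma mem_vacant {c : Fin m → Option Vertex} {i : Fin m} {q : Vertex} :
    q ∈ S.vacant s c i ↔ S.Edge (s.pos i) q ∧ ∀ j ∈ S.comm s i, s.pos j ≠ q ∧ c j ≠ some q := by
  simp [vacant, Edge, and_assoc]

lemma edge_of_mem_support_choiceLaw {c : Fin m → Option Vertex} {i : Fin m} {q : Vertex}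
    (hq : q ∈ (S.choiceLaw s c i).support) : q = s.pos i ∨ S.Edge (s.pos i) q := by
  unfold choiceLaw at hq
  split_ifs at hq with h1 h2
  · rw [PMF.mem_support_uniformOfFinset_iff] at hq
    exact Or.inr (mem_vacant.1 (Finset.mem_sdiff.1 hq).1).1
  · rw [PMF.mem_support_uniformOfFinset_iff] at hq
    exact Or.inr (mem_vacant.1 (Finset.mem_inter.1 hq).1).1
  · rw [PMF.mem_support_pure_iff] at hq
    exact Or.inl hq

lemma edge_of_mem_support_choose {L : List (Fin m)} {c₀ c : Fin m → Option Vertex}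
    (hc : c ∈ (S.choose s L c₀).support)
    (h₀ : ∀ i q, c₀ i = some q → q = s.pos i ∨ S.Edge (s.pos i) q) :
    ∀ i q, c i = some q → q = s.pos i ∨ S.Edge (s.pos i) q := by
  induction L generalizing c₀ with
  | nil => rw [choose, PMF.mem_support_pure_iff] at hc; exact hc ▸ h₀
  | cons i L ih =>
    rw [choose, PMF.mem_support_bind_iff] at hc
    obtain ⟨q, hq, hc⟩ := hc
    refine ih hc fun j q' hj => ?_
    by_cases hji : j = i
    · subst hji
      rw [Function.update_self, Option.some.injEq] at hj
      exact hj ▸ edge_of_mem_support_choiceLaw hq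
    · rw [Function.update_of_ne hji] at hj
      exact h₀ j q' hj

lemma eq_of_mem_support_choose {L : List (Fin m)} {c₀ c : Fin m → Option Vertex}
    (hc : c ∈ (S.choose s L c₀).support) {j : Fin m} (hj : j ∉ L) : c j = c₀ j := by
  induction L generalizing c₀ with
  | nil => rw [choose, PMF.mem_support_pure_iff] at hc; rw [hc]
  | cons i L ih =>
    rw [choose, PMF.mem_support_bind_iff] at hc
    obtain ⟨q, hq, hc⟩ := hc
    rw [List.mem_cons, not_or] at hj
    rw [ih hc hj.2, Function.update_of_ne hj.1]

/-- If the edge from robot `i` to the unoccupied vertex `q` is admissible, then with positive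
probability some robot discovers a vertex that is not in its map, or some robot moves to `q`: when
robot `i` cannot go to `q` this is because a robot of higher priority does or because it prefers
an unvisited vertex. -/
lemma exists_mem_support_choose {L : List (Fin m)} (hL : L.Nodup) {i : Fin m} (hi : i ∈ L)
    {q : Vertex} (hq : S.Edge (s.pos i) q) (hfree : ∀ j, s.pos j ≠ q)
    {c₀ : Fin m → Option Vertex} (h₀ : ∀ k ∈ L, c₀ k = none) :
    ∃ c ∈ (S.choose s L c₀).support,
      (∃ j q', c j = some q' ∧ q' ∉ S.visited₂ s j) ∨ ∃ j, c j = some q := by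
  induction L generalizing c₀ with
  | nil => simp at hi
  | cons j L ih =>
    by_cases hk : ∃ k, c₀ k = some q
    · obtain ⟨k, hk⟩ := hk
      obtain ⟨c, hc⟩ := (S.choose s (j :: L) c₀).support_nonempty
      refine ⟨c, hc, Or.inr ⟨k, ?_⟩⟩
      rw [eq_of_mem_support_choose hc, hk]
      intro hkL
      rw [h₀ k hkL] at hk
      cases hk
    push Not at hk
    rw [List.nodup_cons] at hL
    simp only [choose, PMF.mem_support_bind_iff]
    by_cases hji : i = j
    · subst hji
      have hvac : q ∈ S.vacant s c₀ i := mem_vacant.2 ⟨hq, fun k _ => ⟨hfree k, hk k⟩⟩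
      by_cases hu : (S.vacant s c₀ i \ S.visited₂ s i).Nonempty
      · obtain ⟨q', hq'⟩ := id hu
        obtain ⟨c, hc⟩ := (S.choose s L (Function.update c₀ i (some q'))).support_nonempty
        refine ⟨c, ⟨q', ?_, hc⟩, Or.inl ⟨i, q', ?_, (Finset.mem_sdiff.1 hq').2⟩⟩
        · rw [choiceLaw, dif_pos hu, PMF.mem_support_uniformOfFinset_iff]; exact hq'
        · rw [eq_of_mem_support_choose hc hL.1, Function.update_self]
      · have hqv : q ∈ S.vacant s c₀ i ∩ S.visited₂ s i := by
          rw [Finset.not_nonempty_iff_eq_empty, Finset.sdiff_eq_empty_iff_subset] at hu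
          exact Finset.mem_inter.2 ⟨hvac, hu hvac⟩
        obtain ⟨c, hc⟩ := (S.choose s L (Function.update c₀ i (some q))).support_nonempty
        refine ⟨c, ⟨q, ?_, hc⟩, Or.inr ⟨i, ?_⟩⟩
        · rw [choiceLaw, dif_neg hu, dif_pos (show Finset.Nonempty _ from ⟨q, hqv⟩),
            PMF.mem_support_uniformOfFinset_iff]
          exact hqv
        · rw [eq_of_mem_support_choose hc hL.1, Function.update_self]
    · have hiL : i ∈ L := (List.mem_cons.1 hi).resolve_left hji
      obtain ⟨q', hq'⟩ := (S.choiceLaw s c₀ j).support_nonempty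
      obtain ⟨c, hc, h⟩ := ih hL.2 hiL (c₀ := Function.update c₀ j (some q')) (by
        intro k hkL
        have hkj : k ≠ j := by rintro rfl; exact hL.1 hkL
        rw [Function.update_of_ne hkj]
        exact h₀ k (List.mem_cons_of_mem _ hkL))
      exact ⟨c, ⟨q', hq', hc⟩, h⟩

lemma order_perm : (S.order s).Perm (List.finRange m) := List.mergeSort_perm _ _

/-! ### One loop of the algorithm -/

lemma mem_support_step_of_not_stops (h1 : s.stopped ≠ true) (h2 : ¬ ∃ i, S.Stops s sit i)
    (s' : State m n) : s' ∈ (S.step s sit).support ↔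
      ∃ c ∈ (S.choose s (S.order s) fun _ => none).support, S.move s sit c = s' := by
  rw [step, if_neg h1, if_neg h2, PMF.mem_support_map_iff]

lemma mem_support_step {s' : State m n} (h : s' ∈ (S.step s sit).support) :
    (s.stopped = true ∧ s' = s) ∨ (∃ i, S.Stops s sit i) ∧ s' = S.halt s sit ∨
      ∃ c, (∀ i q, c i = some q → q = s.pos i ∨ S.Edge (s.pos i) q) ∧ s' = S.move s sit c := by
  by_cases h1 : s.stopped = true
  · rw [step, if_pos h1, PMF.mem_support_pure_iff] at h
    exact Or.inl ⟨h1, h⟩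
  by_cases h2 : ∃ i, S.Stops s sit i
  · rw [step, if_neg h1, if_pos h2, PMF.mem_support_pure_iff] at h
    exact Or.inr (Or.inl ⟨h2, h⟩)
  · rw [mem_support_step_of_not_stops h1 h2] at h
    obtain ⟨c, hc, rfl⟩ := h
    exact Or.inr (Or.inr ⟨c, edge_of_mem_support_choose hc (by simp), rfl⟩)

lemma exists_known_of_mem_support_step {s' : State m n} (h : s' ∈ (S.step s sit).support)
    {t : Fin n} (ht : ∃ i, t ∈ s.known i) : ∃ i, t ∈ s'.known i := by
  obtain ⟨i, hi⟩ := ht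
  obtain ⟨-, rfl⟩ | ⟨-, rfl⟩ | ⟨c, -, rfl⟩ := mem_support_step h
  · exact ⟨i, hi⟩
  · exact ⟨i, Finset.mem_biUnion.2 ⟨i, Finset.mem_univ _, known_subset_known' i hi⟩⟩
  · exact ⟨i, known_subset_known' i hi⟩

lemma invariant_init (hK : S.SearchGraph K) : S.Invariant K S.init where
  pos_mem := hK.start_mem
  visited_subset _ := Finset.empty_subset _
  blocked_subset _ := Finset.empty_subset _
  blocked_not _ q hq := absurd hq (Finset.notMem_empty q)
  seen _ v hv := absurd hv (Finset.notMem_empty v)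
  stopped h := by cases h

lemma Invariant.of_mem_support_step (hK : S.SearchGraph K) (hI : S.Invariant K s)
    {s' : State m n} (h : s' ∈ (S.step s sit).support) : S.Invariant K s' := by
  obtain ⟨-, rfl⟩ | ⟨⟨i, hi⟩, rfl⟩ | ⟨c, hc, rfl⟩ := mem_support_step h
  · exact hI
  · exact
      { pos_mem := hI.pos_mem
        visited_subset := hI.visited₂_subset
        blocked_subset := hI.blocked'_subset
        blocked_not := hI.blocked'_not
        seen := fun _ _ _ => Or.inr fun t _ => hI.allKnown_halt hK hi t
        stopped := fun _ => hI.allKnown_halt hK hi }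
  · have hpos : ∀ i, (c i).getD (s.pos i) ∈ K := by
      intro i
      cases hci : c i with
      | none => exact hI.pos_mem i
      | some q =>
        obtain h | h := hc i q hci
        · subst h; exact hI.pos_mem i
        · exact hK.edge_mem _ (hI.pos_mem i) _ h
    exact
      { pos_mem := hpos
        visited_subset := fun i => Finset.union_subset (hI.visited₂_subset i) fun v hv => by
          obtain ⟨j, -, rfl⟩ := Finset.mem_image.1 hv
          exact hpos j
        blocked_subset := hI.blocked'_subset
        blocked_not := hI.blocked'_not
        seen := fun i v hv => by
          obtain hv | hv := Finset.mem_union.1 hv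
          · exact Or.inr fun t ht => hI.exists_mem_known' hv ht
          · obtain ⟨j, -, hj⟩ := Finset.mem_image.1 hv
            exact Or.inl ⟨j, hj⟩
        stopped := fun h => by cases h }

/-! ### All targets become known with positive probability -/

/-- The targets known to no robot. -/
def unknown (s : State m n) : Finset (Fin n) := by
  classical exact Finset.univ.filter fun t => ¬ ∃ i, t ∈ s.known i

lemma mem_unknown {t : Fin n} : t ∈ unknown s ↔ ¬ ∃ i, t ∈ s.known i := by
  simp [unknown]

lemma unknown_subset {s' : State m n} (h : s' ∈ (S.step s sit).support) :
    unknown s' ⊆ unknown s := by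
  intro t ht
  rw [mem_unknown] at ht ⊢
  exact fun h' => ht (exists_known_of_mem_support_step h h')

/-- The number of vertices of `K` that are still missing in the maps. -/
def slack (K : Finset Vertex) (s : State m n) : ℕ := ∑ i, (K \ s.visited i).card

/-- There is a path of `d` admissible edges from `p` to `v`. -/
def PathLength (S : Setting m n l) (v : Vertex) : ℕ → Vertex → Prop
  | 0, p => p = v
  | d + 1, p => ∃ q, S.Edge p q ∧ PathLength S v d q

lemma exists_pathLength {p v : Vertex} (h : Relation.ReflTransGen S.Edge p v) :
    ∃ d, PathLength S v d p := by
  induction h using Relation.ReflTransGen.head_induction_on with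
  | refl => exact ⟨0, rfl⟩
  | head e _ ih => obtain ⟨d, hd⟩ := ih; exact ⟨d + 1, _, e, hd⟩

lemma slack_move_le (c : Fin m → Option Vertex) : slack K (S.move s sit c) ≤ slack K s :=
  Finset.sum_le_sum fun i _ => Finset.card_le_card <| Finset.sdiff_subset_sdiff subset_rfl <|
    (visited_subset_visited₂ i).trans Finset.subset_union_left

lemma slack_move_lt {c : Fin m → Option Vertex} {j : Fin m} {q : Vertex} (hj : c j = some q)
    (hq : q ∉ S.visited₂ s j) (hqK : q ∈ K) : slack K (S.move s sit c) < slack K s := by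
  refine Finset.sum_lt_sum (fun i _ => Finset.card_le_card <|
    Finset.sdiff_subset_sdiff subset_rfl <|
    (visited_subset_visited₂ i).trans Finset.subset_union_left) ⟨j, Finset.mem_univ _, ?_⟩
  refine Finset.card_lt_card ⟨Finset.sdiff_subset_sdiff subset_rfl <|
    (visited_subset_visited₂ j).trans Finset.subset_union_left, fun h => ?_⟩
  have h1 := h (Finset.mem_sdiff.2 ⟨hqK, fun h' => hq (visited_subset_visited₂ j h')⟩)
  refine (Finset.mem_sdiff.1 h1).2 (Finset.mem_union_right _ (Finset.mem_image.2
    ⟨j, self_mem_group j, ?_⟩))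
  rw [hj, Option.getD_some]

/-- From every state of a run, all targets become known with positive probability.  In each loop,
with positive probability, a new target becomes known, or the maps grow, or a robot gets closer
to a vertex from which a given unknown target is seen. -/
theorem exists_reachable_allKnown (hm : 0 < m) (hK : S.SearchGraph K) (sit : Situation)
    (hI : S.Invariant K s) :
    ∃ s', AllKnown s' ∧ Relation.ReflTransGen (fun x y => y ∈ (S.step x sit).support) s s' := by
  induction hU : (unknown s).card using Nat.strong_induction_on generalizing s with
  | _ U ihU =>
  subst hU
  by_cases hall : AllKnown s
  · exact ⟨s, hall, .refl⟩
  simp only [AllKnown, not_forall] at hall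
  obtain ⟨t, ht⟩ := hall
  obtain ⟨v, hvK, htv⟩ := hK.cover t
  have key : ∀ F d, ∀ s₁ : State m n, S.Invariant K s₁ → (unknown s₁).card ≤ (unknown s).card →
      t ∈ unknown s₁ → slack K s₁ ≤ F → (∃ i, PathLength S v d (s₁.pos i)) →
      ∃ s', AllKnown s' ∧
        Relation.ReflTransGen (fun x y => y ∈ (S.step x sit).support) s₁ s' := by
    intro F
    induction F using Nat.strong_induction_on with
    | _ F ihF =>
    -- After a loop in which `t` becomes known there are fewer unknown targets.
    have hdone : ∀ s₁ : State m n, S.Invariant K s₁ → (unknown s₁).card ≤ (unknown s).card →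
        t ∈ unknown s₁ → ∀ s₂ ∈ (S.step s₁ sit).support, t ∉ unknown s₂ →
        ∃ s', AllKnown s' ∧
          Relation.ReflTransGen (fun x y => y ∈ (S.step x sit).support) s₁ s' := by
      intro s₁ hI₁ hle ht₁ s₂ hs₂ ht₂
      have hlt : (unknown s₂).card < (unknown s).card := (Finset.card_lt_card
        ⟨unknown_subset hs₂, fun h => ht₂ (h ht₁)⟩).trans_le hle
      obtain ⟨s', h1, h2⟩ := ihU _ hlt (hI₁.of_mem_support_step hK hs₂) rfl
      exact ⟨s', h1, .head hs₂ h2⟩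
    intro d
    induction d with
    | zero =>
      rintro s₁ hI₁ hle ht₁ - ⟨i, hi⟩
      obtain ⟨s₂, hs₂⟩ := (S.step s₁ sit).support_nonempty
      refine hdone s₁ hI₁ hle ht₁ s₂ hs₂ ?_
      rw [mem_unknown, not_not]
      have hi' : dist (S.target t) (S.loc (s₁.pos i)) ≤ S.rSt := by
        rw [show s₁.pos i = v from hi]; exact htv
      obtain ⟨j, hj⟩ := exists_mem_known'_of_pos (sit := sit) hi'
      obtain ⟨hst, -⟩ | ⟨-, rfl⟩ | ⟨c, -, rfl⟩ := mem_support_step hs₂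
      · exact absurd (hI₁.stopped hst t) (mem_unknown.1 ht₁)
      · exact ⟨j, Finset.mem_biUnion.2 ⟨j, Finset.mem_univ _, hj⟩⟩
      · exact ⟨j, hj⟩
    | succ d ihd =>
      rintro s₁ hI₁ hle ht₁ hF ⟨i, q, hq, hd⟩
      by_cases hocc : ∃ j, s₁.pos j = q
      · obtain ⟨j, rfl⟩ := hocc
        exact ihd s₁ hI₁ hle ht₁ hF ⟨j, hd⟩
      push Not at hocc
      have hst : s₁.stopped ≠ true := fun h => mem_unknown.1 ht₁ (hI₁.stopped h t)
      by_cases hcalled : ∃ i, S.Stops s₁ sit i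
      · obtain ⟨k, hk⟩ := id hcalled
        refine ⟨S.halt s₁ sit, hI₁.allKnown_halt hK hk, .single ?_⟩
        rw [step, if_neg hst, if_pos hcalled, PMF.mem_support_pure_iff]
      have hperm := S.order_perm (s := s₁)
      obtain ⟨c, hc, h⟩ := exists_mem_support_choose (c₀ := fun _ => none)
        (hperm.nodup_iff.2 (List.nodup_finRange m)) (hperm.mem_iff.2 (List.mem_finRange i))
        hq hocc (fun _ _ => rfl)
      have hs₂ : S.move s₁ sit c ∈ (S.step s₁ sit).support :=
        (mem_support_step_of_not_stops hst hcalled _).2 ⟨c, hc, rfl⟩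
      by_cases ht₂ : t ∈ unknown (S.move s₁ sit c)
      swap
      · exact hdone s₁ hI₁ hle ht₁ _ hs₂ ht₂
      have hI₂ := hI₁.of_mem_support_step hK hs₂
      have hle₂ := (Finset.card_le_card (unknown_subset hs₂)).trans hle
      suffices ∃ s', AllKnown s' ∧ Relation.ReflTransGen
          (fun x y => y ∈ (S.step x sit).support) (S.move s₁ sit c) s' by
        obtain ⟨s', h1, h2⟩ := this
        exact ⟨s', h1, .head hs₂ h2⟩
      obtain ⟨j, q', hj, hq'⟩ | ⟨j, hj⟩ := h
      · have hq'K : q' ∈ K := by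
          obtain h | h := edge_of_mem_support_choose hc (by simp) j q' hj
          · exact h ▸ hI₁.pos_mem j
          · exact hK.edge_mem _ (hI₁.pos_mem j) _ h
        obtain ⟨d', hd'⟩ := exists_pathLength (hK.connected _ (hI₂.pos_mem i) v hvK)
        exact ihF _ ((slack_move_lt hj hq' hq'K).trans_le hF) d' _ hI₂ hle₂ ht₂ le_rfl
          ⟨i, hd'⟩
      · refine ihd _ hI₂ hle₂ ht₂ ((slack_move_le c).trans hF) ⟨j, ?_⟩
        change PathLength S v d ((c j).getD _)
        rw [hj]; exact hd
  obtain ⟨d, hd⟩ := exists_pathLength (hK.connected _ (hI.pos_mem ⟨0, hm⟩) v hvK)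
  exact key _ d s hI le_rfl (mem_unknown.2 ht) le_rfl ⟨_, hd⟩

/-- The theorem on the search, given the finite connected graph on which the robots move. -/
theorem SearchGraph.ae_allKnown (hm : 0 < m) (hK : S.SearchGraph K) {Ω : Type*}
    [MeasurableSpace Ω] {μ : Measure Ω} [IsProbabilityMeasure μ] {X : ℕ → Ω → State m n}
    (hX : S.Runs sit μ X) :
    ∀ᵐ ω ∂μ, ∃ k₀ : ℕ, 0 < k₀ ∧ ∀ k ≥ k₀, ∀ t : Fin n, ∃ i : Fin m, t ∈ (X k ω).known i := by
  have hreach := ae_exists_mem_of_reachable (P := fun x => S.step x sit) hX.measurable hX.markov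
    hX.init (F := {x | S.Invariant K x}) (G := {x | AllKnown x}) (S.finite_setOf_invariant K)
    (invariant_init hK) (fun x hx y hy => Invariant.of_mem_support_step hK hx hy)
    (fun x _ hx y hy t => exists_known_of_mem_support_step hy (hx t))
    (fun x hx => exists_reachable_allKnown hm hK sit hx)
  filter_upwards [hreach, ae_transition_mem_support (P := fun x => S.step x sit) hX.measurable
    hX.markov] with ω ⟨k, hk⟩ hω
  refine ⟨k + 1, k.succ_pos, fun k' hk' => ?_⟩
  have hkk' : k ≤ k' := by omega
  clear hk'
  induction k', hkk' using Nat.le_induction with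
  | base => exact hk
  | succ k' _ ih => exact fun t => exists_known_of_mem_support_step (hω k') (ih t)

end Setting

/-! ### Equilateral triangles -/

section Triangle

variable {E : Type*} [NormedAddCommGroup E] [InnerProductSpace ℝ E]

open scoped RealInnerProductSpace

lemma norm_sq_comb {U V : E} {a : ℝ} (hU : ‖U‖ = a) (hV : ‖V‖ = a) (hUV : ‖U - V‖ = a)
    (x y : ℝ) : ‖x • U + y • V‖ ^ 2 = a ^ 2 * (x ^ 2 + x * y + y ^ 2) := by
  have h := norm_sub_sq_real U V
  rw [hU, hV, hUV] at h
  rw [norm_add_sq_real, norm_smul, norm_smul, mul_pow, mul_pow, real_inner_smul_left,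
    real_inner_smul_right, hU, hV, Real.norm_eq_abs, Real.norm_eq_abs, sq_abs, sq_abs]
  linear_combination (x * y) * h

/-- In a cone with an angle of 60°, two points at distance at most `ρ` from the apex are at distance
at most `ρ` from each other. -/
lemma dist_le_of_sector {p q r : E} {a ρ : ℝ} (hpq : dist p q = a) (hpr : dist p r = a)
    (hqr : dist q r = a) {x y x' y' : ℝ} (hx : 0 ≤ x) (hy : 0 ≤ y) (hx' : 0 ≤ x') (hy' : 0 ≤ y')
    (h : dist p (p + x • (q - p) + y • (r - p)) ≤ ρ)
    (h' : dist p (p + x' • (q - p) + y' • (r - p)) ≤ ρ) :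
    dist (p + x • (q - p) + y • (r - p)) (p + x' • (q - p) + y' • (r - p)) ≤ ρ := by
  have hρ : 0 ≤ ρ := dist_nonneg.trans h
  have hU : ‖q - p‖ = a := by rw [← dist_eq_norm, dist_comm, hpq]
  have hV : ‖r - p‖ = a := by rw [← dist_eq_norm, dist_comm, hpr]
  have hUV : ‖(q - p) - (r - p)‖ = a := by rw [sub_sub_sub_cancel_right, ← dist_eq_norm, hqr]
  have key := norm_sq_comb hU hV hUV
  have e1 : ∀ x y : ℝ, dist p (p + x • (q - p) + y • (r - p)) = ‖x • (q - p) + y • (r - p)‖ := by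
    intro x y
    rw [dist_comm, dist_eq_norm]; congr 1; abel
  have e2 : dist (p + x • (q - p) + y • (r - p)) (p + x' • (q - p) + y' • (r - p)) =
      ‖(x - x') • (q - p) + (y - y') • (r - p)‖ := by
    rw [dist_eq_norm]; congr 1; module
  rw [e1] at h h'
  rw [e2]
  have s := pow_le_pow_left₀ (norm_nonneg _) h 2
  have s' := pow_le_pow_left₀ (norm_nonneg _) h' 2
  rw [key] at s s'
  refine le_of_sq_le_sq ?_ hρ
  rw [key]
  -- It suffices to bound the form at the difference by its value at one of the two points.
  suffices H : (x - x') ^ 2 + (x - x') * (y - y') + (y - y') ^ 2 ≤ x ^ 2 + x * y + y ^ 2 ∨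
      (x - x') ^ 2 + (x - x') * (y - y') + (y - y') ^ 2 ≤ x' ^ 2 + x' * y' + y' ^ 2 by
    obtain H | H := H
    · exact (mul_le_mul_of_nonneg_left H (sq_nonneg a)).trans s
    · exact (mul_le_mul_of_nonneg_left H (sq_nonneg a)).trans s'
  rcases le_total x x' with hxx | hxx <;> rcases le_total y y' with hyy | hyy
  · right
    linarith [mul_nonneg hx (sub_nonneg.2 hxx), mul_nonneg hy (sub_nonneg.2 hyy),
      mul_nonneg hx hx', mul_nonneg hy hy', mul_nonneg hx' hy, mul_nonneg hx (sub_nonneg.2 hyy)]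
  · rcases le_total (x' - x) (y - y') with hh | hh
    · left
      linarith [mul_nonneg (sub_nonneg.2 hxx) (sub_nonneg.2 hh), mul_nonneg hy hy',
        mul_nonneg hy' (sub_nonneg.2 hyy), mul_nonneg hx hx, mul_nonneg hx hy]
    · right
      linarith [mul_nonneg (sub_nonneg.2 hyy) (sub_nonneg.2 hh), mul_nonneg hx hx',
        mul_nonneg hx (sub_nonneg.2 hxx), mul_nonneg hy' hy', mul_nonneg hx' hy']
  · rcases le_total (x - x') (y' - y) with hh | hh
    · right
      linarith [mul_nonneg (sub_nonneg.2 hxx) (sub_nonneg.2 hh), mul_nonneg hy hy',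
        mul_nonneg hy (sub_nonneg.2 hyy), mul_nonneg hx' hx', mul_nonneg hx' hy']
    · left
      linarith [mul_nonneg (sub_nonneg.2 hyy) (sub_nonneg.2 hh), mul_nonneg hx hx',
        mul_nonneg hx' (sub_nonneg.2 hxx), mul_nonneg hy hy, mul_nonneg hx hy]
  · left
    linarith [mul_nonneg hx' (sub_nonneg.2 hxx), mul_nonneg hy' (sub_nonneg.2 hyy),
      mul_nonneg hx hx', mul_nonneg hy hy', mul_nonneg hx hy', mul_nonneg hx' (sub_nonneg.2 hyy)]

/-- Let `y₀ y₁` be a segment of the length of the sides of an equilateral triangle, with its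
midpoint in the triangle.  If two vertices are too far from `y₀`, the third one is close to both
ends of the segment. -/
lemma dist_le_of_lt_dist {p q r y₀ y₁ : E} {a : ℝ} (hpq : dist p q = a) (hpr : dist p r = a)
    (hy : dist y₀ y₁ = a) {x y : ℝ} (hx : 0 ≤ x) (hy' : 0 ≤ y) (hxy : x + y ≤ 1)
    (hc : midpoint ℝ y₀ y₁ = p + x • (q - p) + y • (r - p))
    (hq : a < dist q y₀) (hr : a < dist r y₀) : dist p y₀ ≤ a ∧ dist p y₁ ≤ a := by
  have ha : 0 ≤ a := hpq ▸ dist_nonneg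
  set g := p - y₀ with hg
  set U := q - p with hU'
  set V := r - p with hV'
  have hU : ‖U‖ = a := by rw [← dist_eq_norm, dist_comm, hpq]
  have hV : ‖V‖ = a := by rw [← dist_eq_norm, dist_comm, hpr]
  have hqg : q - y₀ = U + g := by rw [hU', hg]; abel
  have hrg : r - y₀ = V + g := by rw [hV', hg]; abel
  have hd : y₁ - y₀ = (2 : ℝ) • (g + x • U + y • V) := by
    have h2 : y₁ - y₀ = (2 : ℝ) • (midpoint ℝ y₀ y₁ - y₀) := by
      rw [midpoint_eq_smul_add]; simp only [smul_sub, smul_smul, invOf_eq_inv]; module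
    rw [h2, hc, hg]; congr 1; abel
  rw [dist_eq_norm, hqg] at hq
  rw [dist_eq_norm, hrg] at hr
  have sq1 := pow_lt_pow_left₀ hq ha two_ne_zero
  have sq2 := pow_lt_pow_left₀ hr ha two_ne_zero
  rw [norm_add_sq_real, hU] at sq1
  rw [norm_add_sq_real, hV] at sq2
  have hp1 : p - y₁ = g - (y₁ - y₀) := by rw [hg]; abel
  have h1 : ‖p - y₁‖ ^ 2 = ‖g‖ ^ 2 - 2 * ⟪g, y₁ - y₀⟫ + a ^ 2 := by
    rw [hp1, norm_sub_sq_real, ← hy, dist_comm, dist_eq_norm y₁]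
  have h2 : ⟪g, y₁ - y₀⟫ = 2 * (‖g‖ ^ 2 + x * ⟪U, g⟫ + y * ⟪V, g⟫) := by
    rw [hd, inner_smul_right, inner_add_right, inner_add_right, inner_smul_right,
      inner_smul_right, real_inner_self_eq_norm_sq, real_inner_comm U, real_inner_comm V]
  have h3 : 0 ≤ x * (2 * ⟪U, g⟫ + ‖g‖ ^ 2) := mul_nonneg hx (by linarith)
  have h4 : 0 ≤ y * (2 * ⟪V, g⟫ + ‖g‖ ^ 2) := mul_nonneg hy' (by linarith)
  have h5 : (x + y) * ‖g‖ ^ 2 ≤ 1 * ‖g‖ ^ 2 := mul_le_mul_of_nonneg_right hxy (sq_nonneg _)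
  have h6 : ‖p - y₁‖ ^ 2 + ‖g‖ ^ 2 ≤ a ^ 2 := by rw [h1, h2]; linarith
  constructor
  · rw [dist_eq_norm]
    exact le_of_sq_le_sq (by nlinarith [sq_nonneg ‖p - y₁‖]) ha
  · rw [dist_eq_norm]
    exact le_of_sq_le_sq (by nlinarith [sq_nonneg ‖g‖]) ha

/-- A point of an equilateral triangle far from all vertices is close to the midpoints of all
sides. -/
lemma dist_midpoint_le_of_lt_dist {p q r c : E} {a : ℝ} (hpq : dist p q = a)
    (hpr : dist p r = a) (hqr : dist q r = a) {x y : ℝ} (hx : 0 ≤ x) (hy : 0 ≤ y) (hxy : x + y ≤ 1)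
    (hc : c = p + x • (q - p) + y • (r - p)) (hp : a / 2 < dist p c) (hq : a / 2 < dist q c)
    (hr : a / 2 < dist r c) : dist (midpoint ℝ p q) c ≤ a / 2 := by
  have ha : 0 ≤ a := hpq ▸ dist_nonneg
  have hU : ‖q - p‖ = a := by rw [← dist_eq_norm, dist_comm, hpq]
  have hV : ‖r - p‖ = a := by rw [← dist_eq_norm, dist_comm, hpr]
  have hUV : ‖(q - p) - (r - p)‖ = a := by rw [sub_sub_sub_cancel_right, ← dist_eq_norm, hqr]
  have key := norm_sq_comb hU hV hUV
  have e1 : p - c = (-x) • (q - p) + (-y) • (r - p) := by rw [hc]; module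
  have e2 : q - c = (1 - x) • (q - p) + (-y) • (r - p) := by rw [hc]; module
  have e3 : r - c = (-x) • (q - p) + (1 - y) • (r - p) := by rw [hc]; module
  have e4 : midpoint ℝ p q - c = (1 / 2 - x) • (q - p) + (-y) • (r - p) := by
    rw [hc, midpoint_eq_smul_add, invOf_eq_inv]; module
  rw [dist_eq_norm, e1] at hp
  rw [dist_eq_norm, e2] at hq
  rw [dist_eq_norm, e3] at hr
  have s1 := pow_lt_pow_left₀ hp (by positivity) two_ne_zero
  have s2 := pow_lt_pow_left₀ hq (by positivity) two_ne_zero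
  have s3 := pow_lt_pow_left₀ hr (by positivity) two_ne_zero
  rw [key, div_pow, div_eq_mul_inv] at s1 s2 s3
  have t1 := lt_of_mul_lt_mul_left s1 (sq_nonneg a)
  have t2 := lt_of_mul_lt_mul_left s2 (sq_nonneg a)
  have t3 := lt_of_mul_lt_mul_left s3 (sq_nonneg a)
  rw [dist_eq_norm, e4]
  refine le_of_sq_le_sq ?_ (by positivity)
  rw [key, div_pow, div_eq_mul_inv]
  refine mul_le_mul_of_nonneg_left ?_ (sq_nonneg a)
  -- The point lies in the triangle of the midpoints of the sides.
  have u1 : 1 / 2 ≤ x + y := by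
    by_contra! h
    nlinarith [mul_nonneg hx hy]
  have u2 : x ≤ 1 / 2 := by
    by_contra! h
    nlinarith [mul_nonneg hy (sub_nonneg.2 hxy)]
  have u3 : y ≤ 1 / 2 := by
    by_contra! h
    nlinarith [mul_nonneg hx (sub_nonneg.2 hxy)]
  nlinarith [mul_nonneg (sub_nonneg.2 u2) (sub_nonneg.2 u1), mul_nonneg hy (sub_nonneg.2 u3)]

end Triangle

/-! ### The triangular grid -/

lemma mem_neighbours {p q : Vertex} : q ∈ neighbours p ↔
    q = (p.1 + 1, p.2) ∨ q = (p.1 - 1, p.2) ∨ q = (p.1, p.2 + 1) ∨ q = (p.1, p.2 - 1) ∨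
      q = (p.1 + 1, p.2 - 1) ∨ q = (p.1 - 1, p.2 + 1) := by
  simp [neighbours]

lemma mem_neighbours_symm {p q : Vertex} (h : q ∈ neighbours p) : p ∈ neighbours q := by
  obtain ⟨p1, p2⟩ := p
  obtain ⟨q1, q2⟩ := q
  simp only [mem_neighbours, Prod.mk.injEq] at h ⊢
  omega

/-- Index of a triangle of the grid: the lower left corner of a unit cell of the lattice and the
half of the cell, `false` for the half at the lower left corner, `true` for the opposite one. -/
abbrev Cell := ℤ × ℤ × Bool

/-- The vertices of a triangle of the grid. -/
def verts : Cell → Finset Vertex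
  | (i, j, false) => {(i, j), (i + 1, j), (i, j + 1)}
  | (i, j, true) => {(i + 1, j + 1), (i + 1, j), (i, j + 1)}

lemma neighbours_of_mem_verts {τ : Cell} {p q : Vertex} (hp : p ∈ verts τ) (hq : q ∈ verts τ)
    (h : p ≠ q) : q ∈ neighbours p := by
  obtain ⟨i, j, _ | _⟩ := τ <;>
  · simp only [verts, Finset.mem_insert, Finset.mem_singleton] at hp hq
    rcases hp with rfl | rfl | rfl <;> rcases hq with rfl | rfl | rfl <;>
      simp [mem_neighbours] at h ⊢

lemma card_verts (τ : Cell) : (verts τ).card = 3 := by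
  obtain ⟨i, j, _ | _⟩ := τ <;>
  exact Finset.card_eq_three.2 ⟨_, _, _, by simp, by simp, by simp, rfl⟩

lemma exists_verts_eq {τ : Cell} {p q : Vertex} (hp : p ∈ verts τ) (hq : q ∈ verts τ)
    (h : p ≠ q) : ∃ r, r ≠ p ∧ r ≠ q ∧ verts τ = {p, q, r} := by
  have h2 : ((verts τ).erase p).erase q ≠ ∅ := by
    rw [← Finset.card_pos.trans Finset.nonempty_iff_ne_empty, Finset.card_erase_of_mem
      (Finset.mem_erase.2 ⟨h.symm, hq⟩), Finset.card_erase_of_mem hp, card_verts]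
    norm_num
  obtain ⟨r, hr⟩ := Finset.nonempty_iff_ne_empty.2 h2
  simp only [Finset.mem_erase] at hr
  refine ⟨r, hr.2.1, hr.1, (Finset.eq_of_subset_of_card_le ?_ ?_).symm⟩
  · simp [Finset.insert_subset_iff, hp, hq, hr.2.2]
  · rw [card_verts, Finset.card_eq_three.2 ⟨p, q, r, h, hr.2.1.symm, hr.1.symm, rfl⟩]

namespace Setting

variable {m n l : ℕ} (S : Setting m n l)

/-- The point with real coordinates `x`, `y` in the lattice basis of the grid. -/
noncomputable def gridPoint (x y : ℝ) : Plane :=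
  S.origin + S.a • (x • dir S.angle + y • dir (S.angle + Real.pi / 3))

/-- First coordinate of a point in the lattice basis, by Cramer's rule. -/
noncomputable def coordX (z : Plane) : ℝ :=
  ((z 0 - S.origin 0) * Real.sin (S.angle + Real.pi / 3) -
    (z 1 - S.origin 1) * Real.cos (S.angle + Real.pi / 3)) / (S.a * (Real.sqrt 3 / 2))

/-- Second coordinate of a point in the lattice basis, by Cramer's rule. -/
noncomputable def coordY (z : Plane) : ℝ :=
  ((z 1 - S.origin 1) * Real.cos S.angle - (z 0 - S.origin 0) * Real.sin S.angle) /
    (S.a * (Real.sqrt 3 / 2))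

lemma loc_eq (v : Vertex) : S.loc v = S.gridPoint v.1 v.2 := rfl

lemma continuous_coordX : Continuous S.coordX := by unfold coordX; fun_prop

lemma continuous_coordY : Continuous S.coordY := by unfold coordY; fun_prop

variable {S}

lemma gridPoint_coord (ha : 0 < S.a) (z : Plane) :
    S.gridPoint (S.coordX z) (S.coordY z) = z := by
  have h3 : 0 < Real.sqrt 3 := by positivity
  have hcs := Real.sin_sq_add_cos_sq S.angle
  ext i
  fin_cases i
  · simp only [gridPoint, coordX, coordY, dir, Real.cos_add, Real.sin_add, Real.cos_pi_div_three,
      Real.sin_pi_div_three, PiLp.add_apply, PiLp.smul_apply, smul_eq_mul, Fin.zero_eta,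
      Matrix.cons_val_zero, Fin.isValue]
    field_simp
    linear_combination ((z 0 - S.origin 0) * Real.sqrt 3) * hcs
  · simp only [gridPoint, coordX, coordY, dir, Real.cos_add, Real.sin_add, Real.cos_pi_div_three,
      Real.sin_pi_div_three, PiLp.add_apply, PiLp.smul_apply, smul_eq_mul, Fin.mk_one,
      Matrix.cons_val_one, Matrix.cons_val_fin_one, Fin.isValue]
    field_simp
    linear_combination ((z 1 - S.origin 1) * Real.sqrt 3) * hcs

lemma dist_gridPoint_sq (x y x' y' : ℝ) :
    dist (S.gridPoint x y) (S.gridPoint x' y') ^ 2 =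
      S.a ^ 2 * ((x - x') ^ 2 + (x - x') * (y - y') + (y - y') ^ 2) := by
  have h33 : Real.sqrt 3 ^ 2 = 3 := Real.sq_sqrt (by norm_num)
  have hcs := Real.sin_sq_add_cos_sq S.angle
  rw [EuclideanSpace.dist_eq, Real.sq_sqrt (by positivity)]
  simp only [gridPoint, dir, Real.cos_add, Real.sin_add, Real.cos_pi_div_three,
      Real.sin_pi_div_three, PiLp.add_apply, PiLp.smul_apply, smul_eq_mul, Fin.sum_univ_two,
      Matrix.cons_val_one, Matrix.cons_val_fin_one, Matrix.cons_val_zero, Fin.isValue,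
      Real.dist_eq, sq_abs]
  linear_combination S.a ^ 2 * ((x - x') ^ 2 + (x - x') * (y - y') + (y - y') ^ 2 / 4 +
    (y - y') ^ 2 / 4 * Real.sqrt 3 ^ 2) * hcs + S.a ^ 2 * (y - y') ^ 2 / 4 * h33

variable (S)

/-! ### Triangles of the grid as closed sets -/

/-- A closed triangle of the grid as a set of points. -/
def cell : Cell → Set Plane
  | (i, j, false) => {z | i ≤ S.coordX z ∧ j ≤ S.coordY z ∧ S.coordX z + S.coordY z ≤ i + j + 1}
  | (i, j, true) =>
    {z | S.coordX z ≤ i + 1 ∧ S.coordY z ≤ j + 1 ∧ i + j + 1 ≤ S.coordX z + S.coordY z}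

lemma isClosed_cell (τ : Cell) : IsClosed (S.cell τ) := by
  have hX := S.continuous_coordX
  have hY := S.continuous_coordY
  obtain ⟨i, j, _ | _⟩ := τ
  · exact (isClosed_le continuous_const hX).inter
      ((isClosed_le continuous_const hY).inter (isClosed_le (hX.add hY) continuous_const))
  · exact (isClosed_le hX continuous_const).inter
      ((isClosed_le hY continuous_const).inter (isClosed_le continuous_const (hX.add hY)))

lemma exists_mem_cell (z : Plane) : ∃ τ, z ∈ S.cell τ := by
  rcases le_total (S.coordX z + S.coordY z) (⌊S.coordX z⌋ + ⌊S.coordY z⌋ + 1) with h | h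
  · exact ⟨(⌊S.coordX z⌋, ⌊S.coordY z⌋, false), Int.floor_le _, Int.floor_le _, h⟩
  · exact ⟨(⌊S.coordX z⌋, ⌊S.coordY z⌋, true), (Int.lt_floor_add_one _).le,
      (Int.lt_floor_add_one _).le, h⟩

variable {S}

lemma mem_cell_bounds {i j : ℤ} {b : Bool} {z : Plane} (h : z ∈ S.cell (i, j, b)) :
    (i ≤ S.coordX z ∧ S.coordX z ≤ i + 1) ∧ j ≤ S.coordY z ∧ S.coordY z ≤ j + 1 := by
  obtain _ | _ := b <;>
  · obtain ⟨h1, h2, h3⟩ := h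
    refine ⟨⟨?_, ?_⟩, ?_, ?_⟩ <;> linarith

lemma locallyFinite_cell : LocallyFinite S.cell := by
  intro z
  refine ⟨{z' | |S.coordX z' - S.coordX z| < 1 ∧ |S.coordY z' - S.coordY z| < 1}, ?_, ?_⟩
  · have hX := S.continuous_coordX
    have hY := S.continuous_coordY
    refine IsOpen.mem_nhds ?_ (by simp)
    exact (isOpen_lt (hX.sub continuous_const).abs continuous_const).inter
      (isOpen_lt (hY.sub continuous_const).abs continuous_const)
  · refine ((Set.finite_Icc (⌊S.coordX z⌋ - 2) (⌊S.coordX z⌋ + 2)).prod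
      ((Set.finite_Icc (⌊S.coordY z⌋ - 2) (⌊S.coordY z⌋ + 2)).prod
        (Set.finite_univ (α := Bool)))).subset ?_
    rintro ⟨i, j, b⟩ ⟨z', hz', h1, h2⟩
    obtain ⟨⟨b1, b2⟩, b3, b4⟩ := mem_cell_bounds hz'
    rw [abs_lt] at h1 h2
    have f1 := Int.floor_le (S.coordX z)
    have f2 := Int.lt_floor_add_one (S.coordX z)
    have f3 := Int.floor_le (S.coordY z)
    have f4 := Int.lt_floor_add_one (S.coordY z)
    have g1 : (⌊S.coordX z⌋ : ℝ) < i + 2 + 1 := by linarith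
    have g2 : (i : ℝ) < ⌊S.coordX z⌋ + 2 + 1 := by linarith
    have g3 : (⌊S.coordY z⌋ : ℝ) < j + 2 + 1 := by linarith
    have g4 : (j : ℝ) < ⌊S.coordY z⌋ + 2 + 1 := by linarith
    norm_cast at g1 g2 g3 g4
    simp only [Set.mem_prod, Set.mem_Icc, Set.mem_univ, and_true]
    omega

lemma dist_loc_sq (ha : 0 < S.a) (v : Vertex) (z : Plane) : dist (S.loc v) z ^ 2 =
    S.a ^ 2 * ((v.1 - S.coordX z) ^ 2 + (v.1 - S.coordX z) * (v.2 - S.coordY z) +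
      (v.2 - S.coordY z) ^ 2) := by
  conv_lhs => rw [← gridPoint_coord ha z, loc_eq, dist_gridPoint_sq]

lemma dist_loc_le_iff (ha : 0 < S.a) {v : Vertex} {z : Plane} {ρ : ℝ} (hρ : 0 ≤ ρ) :
    dist (S.loc v) z ≤ S.a * ρ ↔ (v.1 - S.coordX z) ^ 2 +
      (v.1 - S.coordX z) * (v.2 - S.coordY z) + (v.2 - S.coordY z) ^ 2 ≤ ρ ^ 2 := by
  rw [← sq_le_sq₀ dist_nonneg (by positivity), dist_loc_sq ha, mul_pow,
    mul_le_mul_iff_right₀ (by positivity)]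

lemma dist_loc_neighbours (ha : 0 < S.a) {p q : Vertex} (h : q ∈ neighbours p) :
    dist (S.loc p) (S.loc q) = S.a := by
  rw [← sq_eq_sq₀ dist_nonneg ha.le, loc_eq, loc_eq, dist_gridPoint_sq]
  rw [mem_neighbours] at h
  rcases h with rfl | rfl | rfl | rfl | rfl | rfl <;> push_cast <;> ring

/-- A vertex within half a side of a point of a triangle is a vertex of the triangle: both
coordinates and their sum differ by less than one from those of the point. -/
lemma mem_verts_of_dist_le (ha : 0 < S.a) {τ : Cell} {v : Vertex} {z : Plane}
    (hz : z ∈ S.cell τ) (h : dist (S.loc v) z ≤ S.a / 2) : v ∈ verts τ := by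
  rw [div_eq_mul_inv, dist_loc_le_iff ha (by norm_num)] at h
  obtain ⟨v1, v2⟩ := v
  set x := S.coordX z with hx
  set y := S.coordY z with hy
  simp only at h
  obtain ⟨hx1, hx2⟩ := abs_lt_of_sq_lt_sq' (show ((v1 : ℝ) - x) ^ 2 < 1 ^ 2 by
    nlinarith [sq_nonneg (((v1 : ℝ) - x) + 2 * ((v2 : ℝ) - y))]) one_pos.le
  obtain ⟨hy1, hy2⟩ := abs_lt_of_sq_lt_sq' (show ((v2 : ℝ) - y) ^ 2 < 1 ^ 2 by
    nlinarith [sq_nonneg (((v2 : ℝ) - y) + 2 * ((v1 : ℝ) - x))]) one_pos.le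
  obtain ⟨hs1, hs2⟩ := abs_lt_of_sq_lt_sq' (show ((v1 : ℝ) - x + (v2 - y)) ^ 2 < 1 ^ 2 by
    nlinarith [sq_nonneg (((v2 : ℝ) - y) - ((v1 : ℝ) - x))]) one_pos.le
  obtain ⟨i, j, _ | _⟩ := τ
  · obtain ⟨h1, h2, h3⟩ := hz
    rw [← hx] at h1 h3
    rw [← hy] at h2 h3
    have g1 : (i : ℝ) < v1 + 1 := by linarith
    have g2 : (j : ℝ) < v2 + 1 := by linarith
    have g3 : (v1 : ℝ) + v2 < i + j + 1 + 1 := by linarith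
    norm_cast at g1 g2 g3
    simp only [verts, Finset.mem_insert, Finset.mem_singleton, Prod.mk.injEq]
    omega
  · obtain ⟨h1, h2, h3⟩ := hz
    rw [← hx] at h1 h3
    rw [← hy] at h2 h3
    have g1 : (v1 : ℝ) < i + 1 + 1 := by linarith
    have g2 : (v2 : ℝ) < j + 1 + 1 := by linarith
    have g3 : (i : ℝ) + j + 1 < v1 + v2 + 1 := by linarith
    norm_cast at g1 g2 g3
    simp only [verts, Finset.mem_insert, Finset.mem_singleton, Prod.mk.injEq]
    omega

/-- A point on two triangles of the grid lies on an edge, hence near one of its ends. -/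
lemma exists_dist_le_of_mem_cells (ha : 0 < S.a) {τ τ' : Cell} {z : Plane} (hz : z ∈ S.cell τ)
    (hz' : z ∈ S.cell τ') (h : τ ≠ τ') : ∃ v, dist (S.loc v) z ≤ S.a / 2 := by
  set x := S.coordX z with hx
  set y := S.coordY z with hy
  suffices H : (∃ N : ℤ, x = N) ∨ (∃ N : ℤ, y = N) ∨ ∃ N : ℤ, x + y = N by
    have round_sq : ∀ u : ℝ, (u - round u) ^ 2 ≤ 1 / 4 := by
      intro u
      have := pow_le_pow_left₀ (abs_nonneg _) (abs_sub_round u) 2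
      rw [sq_abs] at this
      linarith
    simp only [div_eq_mul_inv, dist_loc_le_iff ha (show (0 : ℝ) ≤ 2⁻¹ by norm_num), ← hx, ← hy]
    obtain ⟨N, hN⟩ | ⟨N, hN⟩ | ⟨N, hN⟩ := H
    · refine ⟨(N, round y), ?_⟩
      rw [hN]
      linarith [round_sq y]
    · refine ⟨(round x, N), ?_⟩
      rw [hN]
      linarith [round_sq x]
    · refine ⟨(round x, N - round x), ?_⟩
      have : y = N - x := by linarith
      rw [this]
      push_cast
      linarith [round_sq x]
  by_contra! H
  obtain ⟨H1, H2, H3⟩ := H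
  have fl : ∀ (u : ℝ) (N M : ℤ), (∀ K : ℤ, u ≠ K) → (N : ℝ) ≤ u → u ≤ N + 1 → (M : ℝ) ≤ u →
      u ≤ M + 1 → N = M := by
    intro u N M hu h1 h2 h3 h4
    have h2' : u < N + 1 := lt_of_le_of_ne h2 (by exact_mod_cast hu (N + 1))
    have h4' : u < M + 1 := lt_of_le_of_ne h4 (by exact_mod_cast hu (M + 1))
    have g1 : (N : ℝ) < M + 1 := by linarith
    have g2 : (M : ℝ) < N + 1 := by linarith
    norm_cast at g1 g2
    omega
  obtain ⟨i, j, b⟩ := τ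
  obtain ⟨i', j', b'⟩ := τ'
  obtain ⟨⟨b1, b2⟩, b3, b4⟩ := mem_cell_bounds hz
  obtain ⟨⟨c1, c2⟩, c3, c4⟩ := mem_cell_bounds hz'
  obtain rfl := fl x i i' H1 b1 b2 c1 c2
  obtain rfl := fl y j j' H2 b3 b4 c3 c4
  have hs : x + y ≠ i + j + 1 := by exact_mod_cast H3 (i + j + 1)
  obtain _ | _ := b <;> obtain _ | _ := b'
  · exact h rfl
  · exact hs (le_antisymm hz.2.2 hz'.2.2)
  · exact hs (le_antisymm hz'.2.2 hz.2.2)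
  · exact h rfl

lemma exists_weights (ha : 0 < S.a) {τ : Cell} {z : Plane} (hz : z ∈ S.cell τ) :
    ∃ w : Vertex → ℝ, (∀ v ∈ verts τ, 0 ≤ w v) ∧ ∑ v ∈ verts τ, w v = 1 ∧
      ∑ v ∈ verts τ, w v • S.loc v = z := by
  obtain ⟨i, j, _ | _⟩ := τ
  · obtain ⟨h1, h2, h3⟩ := hz
    refine ⟨fun v => if v = (i, j) then i + j + 1 - S.coordX z - S.coordY z
      else if v = (i + 1, j) then S.coordX z - i else S.coordY z - j, ?_, ?_, ?_⟩
    · intro v hv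
      dsimp only
      split_ifs <;> linarith
    · simp [verts]
      ring
    · conv_rhs => rw [← gridPoint_coord ha z]
      simp [verts, loc_eq, gridPoint]
      module
  · obtain ⟨h1, h2, h3⟩ := hz
    refine ⟨fun v => if v = (i + 1, j + 1) then S.coordX z + S.coordY z - i - j - 1
      else if v = (i + 1, j) then j + 1 - S.coordY z else i + 1 - S.coordX z, ?_, ?_, ?_⟩
    · intro v hv
      dsimp only
      split_ifs <;> linarith
    · simp [verts]
      ring
    · conv_rhs => rw [← gridPoint_coord ha z]
      simp [verts, loc_eq, gridPoint]
      module

/-- The affine description of a triangle of the grid from any of its vertices. -/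
lemma exists_affine (ha : 0 < S.a) {τ : Cell} {p q : Vertex} (hp : p ∈ verts τ)
    (hq : q ∈ verts τ) (hpq : p ≠ q) : ∃ r, r ≠ p ∧ r ≠ q ∧ verts τ = {p, q, r} ∧
      ∀ z ∈ S.cell τ, ∃ x y : ℝ, 0 ≤ x ∧ 0 ≤ y ∧ x + y ≤ 1 ∧
        z = S.loc p + x • (S.loc q - S.loc p) + y • (S.loc r - S.loc p) := by
  obtain ⟨r, hrp, hrq, hv⟩ := exists_verts_eq hp hq hpq
  refine ⟨r, hrp, hrq, hv, fun z hz => ?_⟩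
  obtain ⟨w, hw, hsum, hz⟩ := exists_weights ha hz
  rw [hv] at hw hsum hz
  simp only [Finset.mem_insert, Finset.mem_singleton, forall_eq_or_imp, forall_eq] at hw
  have h1 : p ∉ ({q, r} : Finset Vertex) := by simp [hpq, hrp.symm]
  have h2 : q ∉ ({r} : Finset Vertex) := by simp [hrq.symm]
  rw [Finset.sum_insert h1, Finset.sum_insert h2, Finset.sum_singleton] at hsum hz
  refine ⟨w q, w r, hw.2.1, hw.2.2, by linarith, ?_⟩
  rw [← hz, show w p = 1 - w q - w r by linarith]
  module

/-- The mean of the squared distances from a point of a triangle of side one to the vertices, with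
the barycentric coordinates of the point as weights, is at most `1 / 3`. -/
lemma not_lt_circumradius_sq {u w : ℝ} (hu : 0 ≤ u) (hw : 0 ≤ w) (huw : u + w ≤ 1) :
    ¬ (1 / 3 < u ^ 2 + u * w + w ^ 2 ∧ 1 / 3 < (1 - u) ^ 2 - (1 - u) * w + w ^ 2 ∧
      1 / 3 < u ^ 2 - u * (1 - w) + (1 - w) ^ 2) := by
  rintro ⟨H1, H2, H3⟩
  have h1 := mul_nonneg (sub_nonneg.2 huw) (sub_nonneg.2 H1.le)
  have h2 := mul_nonneg hu (sub_nonneg.2 H2.le)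
  have h3 := mul_nonneg hw (sub_nonneg.2 H3.le)
  have h4 := sq_nonneg (u - w)
  have h5 := sq_nonneg (u + w - 2 / 3)
  rcases hu.eq_or_lt with rfl | hu
  · rcases hw.eq_or_lt with rfl | hw
    · norm_num at H1
    · linarith [mul_pos hw (sub_pos.2 H3)]
  · linarith [mul_pos hu (sub_pos.2 H2)]

/-- A triangle is covered by the discs around its vertices whose radius is the circumradius. -/
lemma exists_dist_le_circumradius (ha : 0 < S.a) {τ : Cell} {z : Plane} (hz : z ∈ S.cell τ) :
    ∃ v ∈ verts τ, dist (S.loc v) z ≤ S.a / Real.sqrt 3 := by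
  have h33 : (Real.sqrt 3)⁻¹ ^ 2 = 1 / 3 := by
    rw [inv_pow, Real.sq_sqrt (by norm_num)]; norm_num
  simp only [div_eq_mul_inv S.a, dist_loc_le_iff ha (show 0 ≤ (Real.sqrt 3)⁻¹ by positivity), h33]
  by_contra! H
  set x := S.coordX z with hx
  set y := S.coordY z with hy
  obtain ⟨i, j, _ | _⟩ := τ
  · obtain ⟨h1, h2, h3⟩ := hz
    rw [← hx] at h1 h3
    rw [← hy] at h2 h3
    have H1 := H (i, j) (by simp [verts])
    have H2 := H (i + 1, j) (by simp [verts])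
    have H3 := H (i, j + 1) (by simp [verts])
    push_cast at H1 H2 H3
    refine not_lt_circumradius_sq (u := x - i) (w := y - j) (by linarith) (by linarith)
      (by linarith) ⟨?_, ?_, ?_⟩ <;> linarith
  · obtain ⟨h1, h2, h3⟩ := hz
    rw [← hx] at h1 h3
    rw [← hy] at h2 h3
    have H1 := H (i + 1, j + 1) (by simp [verts])
    have H2 := H (i + 1, j) (by simp [verts])
    have H3 := H (i, j + 1) (by simp [verts])
    push_cast at H1 H2 H3
    refine not_lt_circumradius_sq (u := i + 1 - x) (w := j + 1 - y) (by linarith) (by linarith)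
      (by linarith) ⟨?_, ?_, ?_⟩ <;> linarith

lemma dist_le_of_mem_cell (ha : 0 < S.a) {τ : Cell} {p : Vertex} {z : Plane}
    (hp : p ∈ verts τ) (hz : z ∈ S.cell τ) : dist (S.loc p) z ≤ S.a := by
  obtain ⟨q, hq, hqp⟩ := Finset.exists_mem_ne (by rw [card_verts τ]; norm_num) p
  obtain ⟨r, hrp, -, hv, h⟩ := exists_affine ha hp hq hqp.symm
  have hr : r ∈ verts τ := by simp [hv]
  obtain ⟨x, y, hx, hy, hxy, hz⟩ := h z hz
  have hU : ‖S.loc q - S.loc p‖ = S.a := by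
    rw [← dist_eq_norm, dist_comm, dist_loc_neighbours ha (neighbours_of_mem_verts hp hq hqp.symm)]
  have hV : ‖S.loc r - S.loc p‖ = S.a := by
    rw [← dist_eq_norm, dist_comm, dist_loc_neighbours ha (neighbours_of_mem_verts hp hr hrp.symm)]
  rw [hz, dist_comm, dist_eq_norm, add_assoc, add_sub_cancel_left]
  refine (norm_add_le _ _).trans ?_
  rw [norm_smul, norm_smul, hU, hV, Real.norm_of_nonneg hx, Real.norm_of_nonneg hy, ← add_mul]
  exact mul_le_of_le_one_left ha.le hxy

/-- A half-edge at a vertex `p` of a triangle is as close as `p` to any point of the triangle. -/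
lemma dist_half_edge_le (ha : 0 < S.a) {τ : Cell} {p q : Vertex} (hp : p ∈ verts τ)
    (hq : q ∈ verts τ) (hpq : p ≠ q) {c : Plane} (hc : c ∈ S.cell τ) {ρ : ℝ}
    (hρ : S.a / 2 ≤ ρ) (hpc : dist (S.loc p) c ≤ ρ) {x : ℝ} (hx : 0 ≤ x) (hx' : x ≤ 1 / 2) :
    dist (S.loc p + x • (S.loc q - S.loc p)) c ≤ ρ := by
  obtain ⟨r, hrp, hrq, hv, h⟩ := exists_affine ha hp hq hpq
  have hr : r ∈ verts τ := by simp [hv]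
  obtain ⟨x', y', hx1, hy1, -, hc'⟩ := h c hc
  have dpq := dist_loc_neighbours ha (neighbours_of_mem_verts hp hq hpq)
  have e : S.loc p + x • (S.loc q - S.loc p) =
      S.loc p + x • (S.loc q - S.loc p) + (0 : ℝ) • (S.loc r - S.loc p) := by
    rw [zero_smul, add_zero]
  rw [hc'] at hpc ⊢
  rw [e]
  refine dist_le_of_sector dpq
    (dist_loc_neighbours ha (neighbours_of_mem_verts hp hr hrp.symm))
    (dist_loc_neighbours ha (neighbours_of_mem_verts hq hr hrq.symm)) hx le_rfl hx1 hy1 ?_ hpc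
  rw [← e, dist_self_add_right, norm_smul, Real.norm_of_nonneg hx, ← dist_eq_norm,
    dist_comm (S.loc q), dpq]
  linarith [mul_le_mul_of_nonneg_right hx' ha.le]

/-- Let the segment `y₀ y₁` have the length of the edges of the grid.  The triangle that contains
its midpoint has a vertex close to both ends. -/
lemma exists_dist_le_both (ha : 0 < S.a) {τ : Cell} {y₀ y₁ : Plane} (hy : dist y₀ y₁ = S.a)
    (hc : midpoint ℝ y₀ y₁ ∈ S.cell τ) :
    ∃ v ∈ verts τ, dist (S.loc v) y₀ ≤ S.a ∧ dist (S.loc v) y₁ ≤ S.a := by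
  by_contra! H
  have two : ∀ z₀ z₁ : Plane, dist z₀ z₁ = S.a → midpoint ℝ z₀ z₁ ∈ S.cell τ →
      (∀ v ∈ verts τ, ¬ (dist (S.loc v) z₀ ≤ S.a ∧ dist (S.loc v) z₁ ≤ S.a)) →
      ∀ q ∈ verts τ, ∀ r ∈ verts τ, q ≠ r → S.a < dist (S.loc q) z₀ →
      S.a < dist (S.loc r) z₀ → False := by
    intro z₀ z₁ hz hc H q hq r hr hqr h1 h2
    obtain ⟨p, hpq, hpr, hv, h⟩ := exists_affine ha hq hr hqr
    have hp : p ∈ verts τ := by simp [hv]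
    obtain ⟨x, y, hx, hy, hxy, hc⟩ := h _ hc
    exact H p hp (dist_le_of_lt_dist (x := 1 - x - y) (y := x)
      (dist_loc_neighbours ha (neighbours_of_mem_verts hp hq hpq))
      (dist_loc_neighbours ha (neighbours_of_mem_verts hp hr hpr)) hz
      (by linarith) hx (by linarith) (by rw [hc]; module) h1 h2)
  have A := two y₀ y₁ hy hc fun v hv h => (H v hv h.1).not_ge h.2
  have B := two y₁ y₀ (by rw [dist_comm, hy]) (by rw [midpoint_comm]; exact hc)
    fun v hv h => (H v hv h.2).not_ge h.1
  have far : ∀ v ∈ verts τ, S.a < dist (S.loc v) y₀ ∨ S.a < dist (S.loc v) y₁ := by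
    intro v hv
    by_contra! h
    exact (H v hv h.1).not_ge h.2
  obtain ⟨p, q, r, hpq, hpr, hqr, hv⟩ := Finset.card_eq_three.1 (card_verts τ)
  have hp : p ∈ verts τ := by simp [hv]
  have hq : q ∈ verts τ := by simp [hv]
  have hr : r ∈ verts τ := by simp [hv]
  rcases far p hp with h1 | h1 <;> rcases far q hq with h2 | h2 <;>
    rcases far r hr with h3 | h3
  · exact A p hp q hq hpq h1 h2
  · exact A p hp q hq hpq h1 h2
  · exact A p hp r hr hpr h1 h3
  · exact B q hq r hr hqr h2 h3
  · exact A q hq r hr hqr h2 h3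
  · exact B p hp r hr hpr h1 h3
  · exact B p hp q hq hpq h1 h2
  · exact B p hp q hq hpq h1 h2

/-! ### Free edges of the grid -/

lemma edge_of_ball_subset {p q : Vertex} (hq : q ∈ neighbours p)
    (h : ∀ z ∈ segment ℝ (S.loc p) (S.loc q), Metric.ball z S.rSafe ⊆ S.region) : S.Edge p q :=
  ⟨hq, fun _ hy z hz => not_lt.1 fun hlt => hy.1 (h z hz hlt)⟩

/-- The obstacle sensors reach far enough to see all objects close to an edge. -/
lemma Edge.ball_subset (hS : S.Assumptions) {p q : Vertex} (h : S.Edge p q) :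
    ∀ z ∈ segment ℝ (S.loc p) (S.loc q), Metric.ball z S.rSafe ⊆ S.region := by
  intro z hz y hy
  by_contra hyD
  refine (Metric.mem_ball.1 hy).not_ge (h.2 y ⟨hyD, ?_⟩ z hz)
  have hzp : dist z (S.loc p) ≤ S.a := by
    have : segment ℝ (S.loc p) (S.loc q) ⊆ Metric.closedBall (S.loc p) S.a :=
      (convex_closedBall _ _).segment_subset (Metric.mem_closedBall_self hS.a_pos.le)
        (Metric.mem_closedBall'.2 (dist_loc_neighbours hS.a_pos h.1).le)
    exact this hz
  linarith [dist_triangle y z (S.loc p), Metric.mem_ball.1 hy, hS.rSo_ge]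

lemma Edge.symm (hS : S.Assumptions) {p q : Vertex} (h : S.Edge p q) : S.Edge q p :=
  edge_of_ball_subset (mem_neighbours_symm h.1) (by
    rw [segment_symm]; exact h.ball_subset hS)

lemma Edge.accessible (hS : S.Assumptions) {p q : Vertex} (h : S.Edge p q) : S.Accessible q :=
  h.ball_subset hS _ (right_mem_segment ℝ _ _)

lemma edge_of_half_edges {τ : Cell} {p q : Vertex} (hp : p ∈ verts τ) (hq : q ∈ verts τ)
    (hpq : p ≠ q)
    (h : ∀ x : ℝ, 0 ≤ x → x ≤ 1 / 2 →
      Metric.ball (S.loc p + x • (S.loc q - S.loc p)) S.rSafe ⊆ S.region)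
    (h' : ∀ x : ℝ, 0 ≤ x → x ≤ 1 / 2 →
      Metric.ball (S.loc q + x • (S.loc p - S.loc q)) S.rSafe ⊆ S.region) : S.Edge p q := by
  refine edge_of_ball_subset (neighbours_of_mem_verts hp hq hpq) fun z hz => ?_
  rw [segment_eq_image'] at hz
  obtain ⟨x, ⟨hx0, hx1⟩, rfl⟩ := hz
  rcases le_total x (1 / 2) with hx | hx
  · exact h x hx0 hx
  · convert h' (1 - x) (by linarith) (by linarith) using 2
    module

variable (S) in
/-- The centres of the discs that are as wide as a passage and fit into the region. -/
def centres : Set Plane := {c | Metric.ball c ((S.a + 2 * S.rSafe) / 2) ⊆ S.region}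

lemma ball_subset_of_dist_centre {z c : Plane} (hc : c ∈ S.centres) (h : dist z c ≤ S.a / 2) :
    Metric.ball z S.rSafe ⊆ S.region :=
  (Metric.ball_subset_ball' (by linarith)).trans hc

variable (S) in
/-- The vertex `v` of the triangle `τ` is close to the centre of a wide disc that lies in `τ`. -/
def Touched (τ : Cell) (v : Vertex) : Prop :=
  v ∈ verts τ ∧ ∃ c ∈ S.centres, c ∈ S.cell τ ∧ dist (S.loc v) c ≤ S.a / 2

lemma Touched.half_edge (ha : 0 < S.a) {τ : Cell} {p q : Vertex} (hp : S.Touched τ p)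
    (hq : q ∈ verts τ) (hpq : p ≠ q) (x : ℝ) (hx : 0 ≤ x) (hx' : x ≤ 1 / 2) :
    Metric.ball (S.loc p + x • (S.loc q - S.loc p)) S.rSafe ⊆ S.region := by
  obtain ⟨hp, c, hc, hcτ, hpc⟩ := hp
  exact ball_subset_of_dist_centre hc (dist_half_edge_le ha hp hq hpq hcτ le_rfl hpc hx hx')

lemma Touched.edge (ha : 0 < S.a) {τ : Cell} {p q : Vertex} (hp : S.Touched τ p)
    (hq : S.Touched τ q) (hpq : p ≠ q) : S.Edge p q :=
  edge_of_half_edges hp.1 hq.1 hpq (hp.half_edge ha hq.1 hpq) (hq.half_edge ha hp.1 hpq.symm)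

lemma Touched.mem (ha : 0 < S.a) {K : Set Vertex} (hK : ∀ p ∈ K, ∀ q, S.Edge p q → q ∈ K)
    {τ : Cell} {p q : Vertex} (hp : S.Touched τ p) (hq : S.Touched τ q) (hpK : p ∈ K) : q ∈ K := by
  by_cases hpq : p = q
  · exact hpq ▸ hpK
  · exact hK p hpK q (hp.edge ha hq hpq)

/-- The connectedness of the set of centres passes to the grid: the triangles with a touched vertex
in the component `K` and the other triangles form two closed sets that do not meet at a centre,
because a centre on two triangles touches a vertex common to both. -/
theorem exists_touched (hS : S.Assumptions) {K : Set Vertex}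
    (hK : ∀ p ∈ K, ∀ q, S.Edge p q → q ∈ K) {τ₀ : Cell} {p : Vertex} (hp : p ∈ K)
    (hpτ : S.Touched τ₀ p) {τ : Cell} {c : Plane} (hc : c ∈ S.centres) (hcτ : c ∈ S.cell τ) :
    ∃ v ∈ K, S.Touched τ v := by
  by_contra hneg
  have ha := hS.a_pos
  have hclosed : ∀ I : Set Cell, IsClosed (⋃ τ : I, S.cell τ) := fun I =>
    (locallyFinite_cell.comp_injective Subtype.val_injective).isClosed_iUnion
      fun τ => S.isClosed_cell τ
  set I : Set Cell := {τ | ∃ v ∈ K, S.Touched τ v} with hI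
  obtain ⟨-, c₀, hc₀, hcτ₀, -⟩ := id hpτ
  obtain ⟨z, hz, hz1, hz2⟩ := isPreconnected_closed_iff.1 hS.passages _ _ (hclosed I) (hclosed Iᶜ)
    (by
      intro z _
      obtain ⟨σ, hσ⟩ := S.exists_mem_cell z
      by_cases h : σ ∈ I
      · exact Or.inl (Set.mem_iUnion.2 ⟨⟨σ, h⟩, hσ⟩)
      · exact Or.inr (Set.mem_iUnion.2 ⟨⟨σ, h⟩, hσ⟩))
    ⟨c₀, hc₀, Set.mem_iUnion.2 ⟨⟨τ₀, p, hp, hpτ⟩, hcτ₀⟩⟩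
    ⟨c, hc, Set.mem_iUnion.2 ⟨⟨τ, hneg⟩, hcτ⟩⟩
  obtain ⟨⟨σ, v, hvK, hvσ⟩, hzσ⟩ := Set.mem_iUnion.1 hz1
  obtain ⟨⟨σ', hσ'⟩, hzσ'⟩ := Set.mem_iUnion.1 hz2
  have hne : σ ≠ σ' := by
    rintro rfl
    exact hσ' ⟨v, hvK, hvσ⟩
  obtain ⟨w, hw⟩ := exists_dist_le_of_mem_cells ha hzσ hzσ' hne
  have hwσ : S.Touched σ w := ⟨mem_verts_of_dist_le ha hzσ hw, z, hz, hzσ, hw⟩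
  exact hσ' ⟨w, hvσ.mem ha hK hwσ hvK, mem_verts_of_dist_le ha hzσ' hw, z, hz, hzσ', hw⟩

lemma finite_setOf_loc_mem (ha : 0 < S.a) {B : Set Plane} (hB : Bornology.IsBounded B) :
    {v | S.loc v ∈ B}.Finite := by
  obtain ⟨M, hM⟩ := hB.subset_closedBall (S.gridPoint 0 0)
  set N : ℤ := ⌈2 * M / S.a⌉
  refine ((Set.finite_Icc (-N) N).prod (Set.finite_Icc (-N) N)).subset ?_
  intro v hv
  have h1 := Metric.mem_closedBall.1 (hM hv)
  have hM0 : 0 ≤ M := dist_nonneg.trans h1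
  have h2 := pow_le_pow_left₀ dist_nonneg h1 2
  rw [loc_eq, dist_gridPoint_sq, sub_zero, sub_zero] at h2
  have hN : 2 * M / S.a ≤ N := Int.le_ceil _
  have bound : ∀ x y : ℝ, S.a ^ 2 * (x ^ 2 + x * y + y ^ 2) ≤ M ^ 2 → |x| ≤ N := by
    intro x y h
    refine le_trans ?_ hN
    rw [le_div_iff₀ ha]
    refine le_of_sq_le_sq ?_ (by positivity)
    rw [mul_pow, sq_abs]
    nlinarith [mul_nonneg (sq_nonneg S.a) (sq_nonneg (x + 2 * y)), sq_nonneg M]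
  have b1 := abs_le.1 (bound _ _ h2)
  have b2 := abs_le.1 (bound v.2 v.1 (by linarith))
  exact ⟨⟨by exact_mod_cast b1.1, by exact_mod_cast b1.2⟩,
    ⟨by exact_mod_cast b2.1, by exact_mod_cast b2.2⟩⟩

/-! ### The two requirements -/

lemma LooseRequirement.exists_mem (hS : S.Assumptions) (hL : S.LooseRequirement) {K : Set Vertex}
    (hK : ∀ p ∈ K, ∀ q, S.Edge p q → q ∈ K)
    (hT : ∀ τ c, c ∈ S.centres → c ∈ S.cell τ → ∃ v ∈ K, S.Touched τ v) (t : Fin n) :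
    ∃ v ∈ K, dist (S.target t) (S.loc v) ≤ S.rSt := by
  have ha := hS.a_pos
  have h3 : 0 < Real.sqrt 3 := by positivity
  have h32 : Real.sqrt 3 ≤ 2 := Real.sqrt_le_iff.2 ⟨by norm_num, by norm_num⟩
  have hρ : S.a / 2 ≤ S.a / Real.sqrt 3 := div_le_div_of_nonneg_left ha.le h3 h32
  have hr : S.a / Real.sqrt 3 ≤ S.rSt := by
    rw [div_le_iff₀' h3]
    refine hL.rSt_ge.trans (mul_le_mul_of_nonneg_left ?_ h3.le)
    linarith [hS.rSafe_ge, hS.err_nonneg]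
  have hball := hL.target_inner t
  have ht : S.target t ∈ S.centres :=
    (Metric.ball_subset_ball (by linarith)).trans hball
  obtain ⟨τ, hτ⟩ := S.exists_mem_cell (S.target t)
  obtain ⟨v₀, hv₀, hv₀τ⟩ := hT τ _ ht hτ
  obtain ⟨v, hv, hvt⟩ := exists_dist_le_circumradius ha hτ
  refine ⟨v, ?_, by rw [dist_comm]; exact hvt.trans hr⟩
  by_cases hne : v₀ = v
  · exact hne ▸ hv₀
  refine hK _ hv₀ _ (edge_of_half_edges hv₀τ.1 hv hne (hv₀τ.half_edge ha hv hne) ?_)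
  intro x hx hx'
  exact (Metric.ball_subset_ball' (by
    linarith [dist_half_edge_le ha hv hv₀τ.1 (Ne.symm hne) hτ hρ hvt hx hx'])).trans hball

/-- A point of `D` that is not the centre of a disc of radius `R` in `D` lies on an inner normal of
a boundary point, in the direction in which the tangent disc of radius `r` lies in `D` near that
point. -/
lemma ConcaveCurvatureLE.exists_normal {D : Set Plane} {r w : ℝ} (hD : ConcaveCurvatureLE D r w)
    {z : Plane} (hz : z ∈ D) {R : ℝ} (hR : ¬ Metric.ball z R ⊆ D) :
    ∃ (x ν : Plane) (ρ : ℝ), ‖ν‖ = 1 ∧ 0 ≤ ρ ∧ ρ < R ∧ z = x + ρ • ν ∧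
      (∀ d, Metric.ball z d ⊆ D → d ≤ ρ) ∧
      Metric.ball (x + r • ν) r ∩ Metric.ball x w ⊆ D := by
  obtain ⟨y, hy, hyD⟩ := Set.not_subset.1 hR
  obtain ⟨x, hx, hzx⟩ := isClosed_closure.exists_infDist_eq_dist
    (⟨y, subset_closure hyD⟩ : (closure Dᶜ).Nonempty) z
  have hmin : ∀ y ∉ D, dist z x ≤ dist z y := fun y hy =>
    hzx ▸ Metric.infDist_le_dist_of_mem (subset_closure hy)
  have hball : Metric.ball z (dist z x) ⊆ D := by
    intro y hy
    by_contra hyD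
    exact (Metric.mem_ball'.1 hy).not_ge (hmin y hyD)
  have hlt : dist z x < R := (hmin y hyD).trans_lt (Metric.mem_ball'.1 hy)
  have hmax : ∀ d, Metric.ball z d ⊆ D → d ≤ dist z x := by
    intro d hd
    by_contra! h
    obtain ⟨u, hu, huD⟩ := mem_closure_iff.1 hx _ Metric.isOpen_ball (Metric.mem_ball'.2 h)
    exact huD (hd hu)
  have hfr : x ∈ closure D → x ∈ frontier D := fun h => by
    rw [frontier_eq_closure_inter_closure]; exact ⟨h, hx⟩
  rcases (dist_nonneg (x := z) (y := x)).eq_or_lt with h0 | h0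
  · have hxz : z = x := dist_eq_zero.1 h0.symm
    subst hxz
    obtain ⟨⟨ν, hν⟩, hL⟩ := hD z (hfr (subset_closure hz))
    refine ⟨z, ν, 0, hν.1, le_rfl, by simpa using hlt, by simp, by simpa using hmax, hL ν hν⟩
  · have hxc : x ∈ closure D := by
      refine closure_mono hball ?_
      rw [closure_ball z h0.ne']
      exact Metric.mem_closedBall'.2 le_rfl
    have hzeq : z = x + dist z x • ((dist z x)⁻¹ • (z - x)) := by
      rw [smul_inv_smul₀ h0.ne', add_sub_cancel]
    have hν : InnerNormal D x ((dist z x)⁻¹ • (z - x)) := by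
      refine ⟨?_, dist z x, h0, hzeq ▸ hball⟩
      rw [norm_smul, norm_inv, Real.norm_of_nonneg h0.le, ← dist_eq_norm, inv_mul_cancel₀ h0.ne']
    exact ⟨x, _, dist z x, hν.1, h0.le, hlt, hzeq, hmax, (hD x (hfr hxc)).2 _ hν⟩

lemma dist_add_smul {x ν : Plane} (hν : ‖ν‖ = 1) (b c : ℝ) :
    dist (x + b • ν) (x + c • ν) = |b - c| := by
  rw [dist_add_left, dist_eq_norm, ← sub_smul, norm_smul, hν, mul_one, Real.norm_eq_abs]

/-- On an inner normal, the point at the distance of half the width of a passage from the boundary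
is the centre of a disc of this width. -/
lemma add_smul_mem_centres (hS : S.Assumptions) (hst : S.a + S.rSafe ≤ S.rSt) {x ν : Plane}
    (hν : ‖ν‖ = 1) (hL : Metric.ball (x + S.rSt • ν) S.rSt ∩
      Metric.ball x (S.a + 2 * S.rSafe) ⊆ S.region) :
    x + (S.a / 2 + S.rSafe) • ν ∈ S.centres := by
  have hs : 0 < S.rSafe := by linarith [hS.rRob_pos, hS.err_nonneg, hS.rSafe_ge]
  have ha := hS.a_pos
  refine (Set.subset_inter (Metric.ball_subset_ball' ?_) (Metric.ball_subset_ball' ?_)).trans hL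
  · rw [dist_add_smul hν, abs_of_nonpos (by linarith)]; linarith
  · rw [dist_self_add_left, norm_smul, hν, Real.norm_of_nonneg (by positivity)]; linarith

lemma StrictRequirement.entrance (hS : S.Assumptions) (hR : S.StrictRequirement) (i : Fin m) :
    ∃ c ∈ S.centres, dist (S.loc (S.start i)) c ≤ S.a / 2 := by
  have hs : 0 < S.rSafe := by linarith [hS.rRob_pos, hS.err_nonneg, hS.rSafe_ge]
  have hacc := hS.start_accessible i
  by_cases h : S.loc (S.start i) ∈ S.centres
  · exact ⟨_, h, by rw [dist_self]; linarith [hS.a_pos]⟩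
  obtain ⟨x, ν, ρ, hν, hρ, hρR, hz, hmax, hL⟩ :=
    ConcaveCurvatureLE.exists_normal hR.curvature (hacc (Metric.mem_ball_self hs)) h
  refine ⟨_, add_smul_mem_centres hS hR.rSt_ge hν hL, ?_⟩
  rw [hz, dist_add_smul hν, abs_of_nonpos (by linarith)]
  linarith [hmax _ hacc]

lemma StrictRequirement.exists_mem (hS : S.Assumptions) (hR : S.StrictRequirement)
    {K : Set Vertex} (hK : ∀ p ∈ K, ∀ q, S.Edge p q → q ∈ K)
    (hT : ∀ τ c, c ∈ S.centres → c ∈ S.cell τ → ∃ v ∈ K, S.Touched τ v) (t : Fin n) :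
    ∃ v ∈ K, dist (S.target t) (S.loc v) ≤ S.rSt := by
  have hs : 0 < S.rSafe := by linarith [hS.rRob_pos, hS.err_nonneg, hS.rSafe_ge]
  have ha := hS.a_pos
  have hst := hR.rSt_ge
  by_cases ht : S.target t ∈ S.centres
  · obtain ⟨τ, hτ⟩ := S.exists_mem_cell (S.target t)
    obtain ⟨v, hv, hvτ⟩ := hT τ _ ht hτ
    refine ⟨v, hv, ?_⟩
    rw [dist_comm]
    linarith [dist_le_of_mem_cell ha hvτ.1 hτ]
  obtain ⟨x, ν, ρ, hν, hρ, hρR, hz, -, hL⟩ :=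
    ConcaveCurvatureLE.exists_normal hR.curvature (hS.target_mem t) ht
  have hc := add_smul_mem_centres hS hst hν hL
  -- Vertices within the grid side of both `y₀` and `y₁` are accessible and see the target.
  set y₀ := x + S.rSafe • ν with hy₀
  set y₁ := x + (S.rSafe + S.a) • ν with hy₁
  set c := x + (S.a / 2 + S.rSafe) • ν with hc'
  have hyy : dist y₀ y₁ = S.a := by
    rw [hy₀, hy₁, dist_add_smul hν, abs_of_nonpos (by linarith)]; ring
  have hmid : midpoint ℝ y₀ y₁ = c := by
    rw [midpoint_eq_smul_add, invOf_eq_inv, hy₀, hy₁, hc']; module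
  have hcy₀ : dist c y₀ = S.a / 2 := by
    rw [hc', hy₀, dist_add_smul hν, abs_of_nonneg (by linarith)]; ring
  have hcy₁ : dist c y₁ = S.a / 2 := by
    rw [hc', hy₁, dist_add_smul hν, abs_of_nonpos (by linarith)]; ring
  set V := Metric.closedBall y₀ S.a ∩ Metric.closedBall y₁ S.a with hV
  have hVconv : Convex ℝ V := (convex_closedBall _ _).inter (convex_closedBall _ _)
  have hVc : ∀ z, dist z c ≤ S.a / 2 → z ∈ V := fun z hz =>
    ⟨(dist_triangle z c y₀).trans (by linarith), (dist_triangle z c y₁).trans (by linarith)⟩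
  have hVx : ∀ z ∈ V, dist z x ≤ S.a + S.rSafe := by
    intro z hz
    have h1 : dist y₀ x = S.rSafe := by
      rw [hy₀, dist_self_add_left, norm_smul, hν, Real.norm_of_nonneg hs.le, mul_one]
    linarith [dist_triangle z y₀ x, Metric.mem_closedBall.1 hz.1]
  have hVball : ∀ z ∈ V, Metric.ball z S.rSafe ⊆ S.region := by
    intro z hz
    have h2 : dist y₁ (x + S.rSt • ν) = S.rSt - S.a - S.rSafe := by
      rw [hy₁, dist_add_smul hν, abs_of_nonpos (by linarith)]; ring
    refine (Set.subset_inter (Metric.ball_subset_ball' ?_) (Metric.ball_subset_ball' ?_)).trans hL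
    · linarith [dist_triangle z y₁ (x + S.rSt • ν), Metric.mem_closedBall.1 hz.2]
    · linarith [hVx z hz]
  suffices h : ∃ v ∈ K, S.loc v ∈ V by
    obtain ⟨v, hv, hvV⟩ := h
    refine ⟨v, hv, ?_⟩
    have hseg : S.target t ∈ segment ℝ x y₁ := by
      rw [segment_eq_image']
      have hpos : 0 < S.rSafe + S.a := by linarith
      refine ⟨ρ / (S.rSafe + S.a), ⟨by positivity, ?_⟩, ?_⟩
      · rw [div_le_one hpos]; linarith
      · simp only [hy₁, add_sub_cancel_left, smul_smul, div_mul_cancel₀ _ hpos.ne']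
        exact hz.symm
    refine (convex_closedBall (S.loc v) S.rSt).segment_subset ?_ ?_ hseg
    · exact Metric.mem_closedBall'.2 ((hVx _ hvV).trans (by linarith))
    · exact Metric.mem_closedBall'.2 ((Metric.mem_closedBall.1 hvV.2).trans (by linarith))
  obtain ⟨τ, hτ⟩ := S.exists_mem_cell c
  obtain ⟨v₀, hv₀, hv₀τ⟩ := hT τ c hc hτ
  by_cases hnear : ∃ v ∈ verts τ, dist (S.loc v) c ≤ S.a / 2
  · obtain ⟨v, hv, hvc⟩ := hnear
    exact ⟨v, hv₀τ.mem ha hK ⟨hv, c, hc, hτ, hvc⟩ hv₀, hVc _ hvc⟩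
  push Not at hnear
  obtain ⟨v, hv, hvV⟩ := exists_dist_le_both ha hyy (hmid.symm ▸ hτ)
  refine ⟨v, ?_, hvV⟩
  by_cases hne : v = v₀
  · exact hne ▸ hv₀
  refine hK _ hv₀ _ (edge_of_half_edges hv₀τ.1 hv (Ne.symm hne)
    (hv₀τ.half_edge ha hv (Ne.symm hne)) fun y hy hy' => hVball _ ?_)
  obtain ⟨r, hrv, hrv₀, hverts, haff⟩ := exists_affine ha hv hv₀τ.1 hne
  have hr : r ∈ verts τ := by simp [hverts]
  obtain ⟨u, w, hu, hw, huw, hcu⟩ := haff c hτ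
  have hm := dist_midpoint_le_of_lt_dist
    (dist_loc_neighbours ha (neighbours_of_mem_verts hv hv₀τ.1 hne))
    (dist_loc_neighbours ha (neighbours_of_mem_verts hv hr hrv.symm))
    (dist_loc_neighbours ha (neighbours_of_mem_verts hv₀τ.1 hr hrv₀.symm)) hu hw huw hcu
    (hnear v hv) (hnear v₀ hv₀τ.1) (hnear r hr)
  refine hVconv.segment_subset hvV (hVc _ hm) ?_
  rw [segment_eq_image']
  refine ⟨2 * y, ⟨by linarith, by linarith⟩, ?_⟩
  simp only [midpoint_eq_smul_add, invOf_eq_inv]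
  module

/-- The component of the initial vertices is a finite graph that is connected under moves and from
which all targets are seen. -/
theorem exists_searchGraph (hm : 0 < m) (hS : S.Assumptions)
    (hreq : S.StrictRequirement ∨ S.LooseRequirement) : ∃ K, S.SearchGraph K := by
  have ha := hS.a_pos
  have hs : 0 < S.rSafe := by linarith [hS.rRob_pos, hS.err_nonneg, hS.rSafe_ge]
  set p₀ := S.start ⟨0, hm⟩
  set K : Set Vertex := {v | Relation.ReflTransGen S.Edge p₀ v} with hKdef
  have hK : ∀ p ∈ K, ∀ q, S.Edge p q → q ∈ K := fun p hp q hq => hp.tail hq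
  have hacc : ∀ p ∈ K, S.Accessible p := by
    intro p hp
    obtain h | ⟨q, -, hq⟩ := Relation.ReflTransGen.cases_tail hp
    · exact h ▸ hS.start_accessible _
    · exact hq.accessible hS
  have hfin : K.Finite := (finite_setOf_loc_mem ha (hS.area_bounded.subset Set.sdiff_subset)).subset
    fun p hp => hacc p hp (Metric.mem_ball_self hs)
  have hentr : ∀ i, ∃ c ∈ S.centres, dist (S.loc (S.start i)) c ≤ S.a / 2 := by
    intro i
    obtain h | h := hreq
    · exact h.entrance hS i
    · obtain ⟨c, hc, hball⟩ := h.entrance i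
      exact ⟨c, by rwa [centres, Set.mem_ofPred_eq, add_div, mul_div_cancel_left₀ _ two_ne_zero],
        hc⟩
  have hstart : ∀ i, ∃ τ, S.Touched τ (S.start i) := by
    intro i
    obtain ⟨c, hc, hd⟩ := hentr i
    obtain ⟨τ, hτ⟩ := S.exists_mem_cell c
    exact ⟨τ, mem_verts_of_dist_le ha hτ hd, c, hc, hτ, hd⟩
  have hp₀ : p₀ ∈ K := Relation.ReflTransGen.refl
  obtain ⟨τ₀, hτ₀⟩ := hstart ⟨0, hm⟩
  have hT : ∀ τ c, c ∈ S.centres → c ∈ S.cell τ → ∃ v ∈ K, S.Touched τ v :=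
    fun τ c hc hcτ => exists_touched hS hK hp₀ hτ₀ hc hcτ
  refine ⟨hfin.toFinset, ?_, ?_, ?_, ?_, ?_⟩
  · intro i
    obtain ⟨τ, hτ⟩ := hstart i
    obtain ⟨-, c, hc, hcτ, -⟩ := id hτ
    obtain ⟨v, hv, hvτ⟩ := hT τ c hc hcτ
    exact hfin.mem_toFinset.2 (hvτ.mem ha hK hτ hv)
  · intro p hp q hq
    exact hfin.mem_toFinset.2 (hK p (hfin.mem_toFinset.1 hp) q hq)
  · exact fun p hp => hacc p (hfin.mem_toFinset.1 hp)
  · intro p hp q hq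
    have hsymm : Std.Symm S.Edge := ⟨fun _ _ h => h.symm hS⟩
    exact (Relation.ReflTransGen.stdSymm.symm _ _ (hfin.mem_toFinset.1 hp)).trans
      (hfin.mem_toFinset.1 hq)
  · intro t
    simp only [hfin.mem_toFinset]
    obtain h | h := hreq
    · exact h.exists_mem hS hK hT t
    · exact h.exists_mem hS hK hT t

end Setting

end GridSearch

theorem mainTheorem2 {m n l : ℕ} (hm : 0 < m) (S : GridSearch.Setting m n l)
    (hS : S.Assumptions) (hreq : S.StrictRequirement ∨ S.LooseRequirement)
    (sit : GridSearch.Situation) {Ω : Type*} [MeasurableSpace Ω]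
    (μ : MeasureTheory.Measure Ω) [MeasureTheory.IsProbabilityMeasure μ]
    (X : ℕ → Ω → GridSearch.State m n) (hX : S.Runs sit μ X) :
    ∀ᵐ ω ∂μ, ∃ k₀ : ℕ, 0 < k₀ ∧ ∀ k ≥ k₀, ∀ t : Fin n, ∃ i : Fin m, t ∈ (X k ω).known i := by
  obtain ⟨K, hK⟩ := GridSearch.Setting.exists_searchGraph hm hS hreq
  exact hK.ae_allKnown hm hX
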